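/- **Theorem 3.1.** A Hausdorff space $Y$ is *stratifiable* if to every open $U\subset Y$ one can assign open sets $U_1,U_2,\dots$ with $\overline{U_n}\subset U$ and $\bigcup_n U_n=U$, such that $U_n\subset V_n$ for all $n$ whenever $U\subset V$. A metric $d$ on the set of points of a topological space $Z$ is *dominating* if for every $z\in Z$ and every open $U\ni z$ there is $\varepsilon>0$ with $\{z' : d(z,z')<\varepsilon\}\subset U$, and *admissible* if it is dominating and continuous as a function on $Z\times Z$. A pseudometric is *totally bounded* if it has a finite $\varepsilon$-net for every $\varepsilon>0$. (Pseudo)metrics are not assumed continuous unless this is said. Let $Y$ be a stratifiable space and $X\subset Y$ a closed subset with more than one point. Then there is a linear operator $T:\mathbb R^{X\times X}\to\mathbb R^{Y\times Y}$, defined on all real-valued functions, such that * (extension) $T(f)|_{X\times X}=f$ for all $f$; * (regularity) $T(f)\ge 0$ whenever $f\ge 0$, and $T(1)=1$; * (tricontinuity) $T$ is continuous when $\mathbb R^{X\times X}$ and $\mathbb R^{Y\times Y}$ both carry the topology of pointwise convergence, when both carry the topology of uniform convergence, and when both carry the topology of uniform convergence on compact sets (the compact-open topology on continuous functions); * $T$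 maps bounded functions to bounded functions, continuous functions to continuous functions, pseudometrics to pseudometrics, and metrics to metrics; * if $Y$ is metrizable, $T$ maps dominating metrics on $X$ to dominating metrics on $Y$, and admissible metrics on $X$ to admissible metrics on $Y$. Moreover, $T$ can be chosen so that it has, in addition to all the properties above, either one of the following two properties (the choice of $T$ may depend on which one is wanted): 1. if $Y$ is completely metrizable and $X$ is compact, then $T$ maps complete admissible metrics on $X$ to complete admissible metrics on $Y$; 2. if $Y$ is separable and $Y\setminus X$ has finite covering dimension, then $T$ maps totally bounded pseudometrics on $X$ to totally bounded pseudometrics on $Y$. -/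

import Mathlib

open Set Filter Topology

/-- A stratifiable space: a Hausdorff space in which one can assign to every open set `U` a
sequence `(S U n)` of open sets with closures inside `U` and union `U`, monotonically in `U`. -/
class StratifiableSpace (Y : Type*) [TopologicalSpace Y] : Prop extends T2Space Y where
  exists_stratification : ∃ S : Set Y → ℕ → Set Y,
    (∀ U, IsOpen U → ∀ n, IsOpen (S U n)) ∧
    (∀ U, IsOpen U → ∀ n, closure (S U n) ⊆ U) ∧
    (∀ U, IsOpen U → ⋃ n, S U n = U) ∧
    (∀ U V, IsOpen U → IsOpen V → U ⊆ V → ∀ n, S U n ⊆ S V n)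

/-- Covering dimension at most `n`: every open cover has an open refinement such that each point
lies in at most `n + 1` of its members. -/
def CoveringDimLE (Z : Type*) [TopologicalSpace Z] (n : ℕ) : Prop :=
  ∀ 𝒰 : Set (Set Z), (∀ U ∈ 𝒰, IsOpen U) → ⋃₀ 𝒰 = univ →
    ∃ 𝒱 : Set (Set Z), (∀ V ∈ 𝒱, IsOpen V) ∧ ⋃₀ 𝒱 = univ ∧
      (∀ V ∈ 𝒱, ∃ U ∈ 𝒰, V ⊆ U) ∧ ∀ z : Z, {V ∈ 𝒱 | z ∈ V}.encard ≤ n + 1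

section Functions

variable {Z : Type*}

/-- A function is bounded. -/
def IsBoundedFun {W : Type*} (f : W → ℝ) : Prop := ∃ M : ℝ, ∀ w, |f w| ≤ M

/-- A pseudometric on a set (not assumed continuous for any topology). -/
structure IsPseudometric (p : Z × Z → ℝ) : Prop where
  nonneg : ∀ x y, 0 ≤ p (x, y)
  self : ∀ x, p (x, x) = 0
  symm : ∀ x y, p (x, y) = p (y, x)
  triangle : ∀ x y z, p (x, z) ≤ p (x, y) + p (y, z)

/-- A metric on a set (not assumed continuous for any topology). -/
structure IsMetric (p : Z × Z → ℝ) : Prop extends IsPseudometric p where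
  eq_of_eq_zero : ∀ x y, p (x, y) = 0 → x = y

/-- A totally bounded pseudometric: for every `ε > 0` there is a finite `ε`-net. -/
structure IsTotallyBoundedPseudometric (p : Z × Z → ℝ) : Prop extends IsPseudometric p where
  exists_net : ∀ ε > 0, ∃ A : Finset Z, ∀ x, ∃ a ∈ A, p (x, a) < ε

variable [TopologicalSpace Z]

/-- A dominating metric: every neighborhood of a point contains a ball around this point. -/
structure IsDominatingMetric (p : Z × Z → ℝ) : Prop extends IsMetric p where
  exists_ball : ∀ (x : Z) (U : Set Z), IsOpen U → x ∈ U → ∃ ε > 0, ∀ y, p (x, y) < ε → y ∈ U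

/-- An admissible metric: one which is both dominating and continuous. -/
structure IsAdmissibleMetric (p : Z × Z → ℝ) : Prop extends IsDominatingMetric p where
  continuous : Continuous p

/-- A complete admissible metric: an admissible metric whose Cauchy sequences all converge. -/
structure IsCompleteAdmissibleMetric (p : Z × Z → ℝ) : Prop extends IsAdmissibleMetric p where
  complete : ∀ u : ℕ → Z, (∀ ε > 0, ∃ N, ∀ m ≥ N, ∀ n ≥ N, p (u m, u n) < ε) →
    ∃ z, Tendsto (fun n => p (u n, z)) atTop (𝓝 0)

end Functions

section Operators

/-- `T f` extends `f`, for every `f`. -/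
def IsExtensionOperator {Y : Type*} {X : Set Y} (T : (X × X → ℝ) →ₗ[ℝ] (Y × Y → ℝ)) : Prop :=
  ∀ (f : X × X → ℝ) (x x' : X), T f (x, x') = f (x, x')

/-- A regular operator: linear (which is bundled), positive and unit-preserving. -/
structure IsRegularOperator {A B : Type*} (T : (A → ℝ) →ₗ[ℝ] (B → ℝ)) : Prop where
  positive : ∀ f, (∀ a, 0 ≤ f a) → ∀ b, 0 ≤ T f b
  map_one : ∀ b, T (fun _ => 1) b = 1

/-- Continuity with respect to pointwise convergence, uniform convergence, and uniform convergence
on compact sets (which induces the compact-open topology on the continuous functions). -/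
structure IsTricontinuous {A B : Type*} [TopologicalSpace A] [TopologicalSpace B]
    (T : (A → ℝ) →ₗ[ℝ] (B → ℝ)) : Prop where
  pointwise : Continuous (fun f : A → ℝ => T f)
  uniform : Continuous (fun f : UniformFun A ℝ => UniformFun.ofFun (T (UniformFun.toFun f)))
  compactOpen : Continuous (fun f : UniformOnFun A ℝ {K | IsCompact K} =>
    UniformOnFun.ofFun {K : Set B | IsCompact K} (T (UniformOnFun.toFun {K | IsCompact K} f)))

variable {Y : Type*} [TopologicalSpace Y] {X : Set Y}

/-- A regular tricontinuous extension operator preserving the classes of bounded functions,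
continuous functions, pseudometrics and metrics. -/
structure IsGoodExtension (T : (X × X → ℝ) →ₗ[ℝ] (Y × Y → ℝ)) : Prop where
  extension : IsExtensionOperator T
  regular : IsRegularOperator T
  tricontinuous : IsTricontinuous T
  bounded : ∀ f, IsBoundedFun f → IsBoundedFun (T f)
  continuous : ∀ f, Continuous f → Continuous (T f)
  pseudometric : ∀ p, IsPseudometric p → IsPseudometric (T p)
  metric : ∀ p, IsMetric p → IsMetric (T p)

/-- The operator preserves the classes of dominating metrics and of admissible metrics. -/
structure PreservesDominatingAdmissible (T : (X × X → ℝ) →ₗ[ℝ] (Y × Y → ℝ)) : Prop where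
  dominating : ∀ p, IsDominatingMetric p → IsDominatingMetric (T p)
  admissible : ∀ p, IsAdmissibleMetric p → IsAdmissibleMetric (T p)

end Operators

/-! Each point y of Y is given a random element Φ_y of the disjoint union of X with a set L of
labels, with Φ_x = x for x in X, and T(f)(y, y') is the expectation of f̃(Φ_y, Φ_y'), where f̃ =
`pairExtension a b f`. A label acts as a fair coin between two fixed points a ≠ b of X, and distinct
labels use opposite coins. Thus f ↦ f̃ is linear and positive, respects the triangle inequality, and
puts every label at distance at least p(a, b) / 2 from all else. Extension, regularity and the
preservation of pseudometrics follow by integration. Since Φ_y has finitely many values in X,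
|T(f)(y, y')| is at most the maximum of |f| over a finite set (`abs_operator_le`); over a compact
set of points y these finite sets stay in one compact set (`exists_compact_support`). This gives the
three continuities. Continuous functions are preserved because Φ is continuous in measure
(`isContinuousFamily`).

The probability space is ℕ × [0,1]. For y outside X and ω = (m, t), the value Φ_y(ω) is a label
taken from the m-th selection system if t < s(y), and otherwise a point of X near y taken from the
main system; here s is continuous and vanishes exactly on X. A selection system picks the first k
whose weight at y exceeds t. Two points whose labels differ with positive probability are at
positive T(p)-distance (`le_extensionOperator`), so metrics go to metrics. If the labels separate a
point from the complement of each of its neighborhoods, and if a small s(y) with a chosen point near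
x₀ forces y to be near x₀, then dominating metrics are preserved.

A T(p)-Cauchy sequence along which s stays away from 0 is Cauchy in Y, since the m-th labels
separate points that are not close; otherwise it clusters at the compact set X. Total boundedness
holds when boundedly many weights are positive at each point and each label system has finitely many
values: up to a small event, Φ_y is then described by finitely much data.

The required covers exist in every stratifiable space: open covers have σ-discrete closed
refinements which expand to disjoint open sets (`exists_functions_of_open_cover`), and the points of
X attached to a cover of the complement are made to converge at X by maximizing a rank
(`exists_convergent_cover`). In a metrizable space balls do the same and give the stronger
properties. -/

open MeasureTheory
open scoped ENNReal unitInterval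

/-! ### Functions of two variables on a set enlarged by labels -/

section PairExtension

variable {A L : Type*}

open scoped Classical in
/-- The extension of a function of two variables from `A` to the disjoint union of `A` with a set
of labels. A pair of distinct labels behaves like the pair `(a, b)`. -/
noncomputable def pairExtension (a b : A) (f : A × A → ℝ) : A ⊕ L → A ⊕ L → ℝ
  | .inl x, .inl y => f (x, y)
  | .inl x, .inr _ => (f (x, a) + f (x, b)) / 2
  | .inr _, .inl y => (f (a, y) + f (b, y)) / 2
  | .inr v, .inr w => if v = w then (f (a, a) + f (b, b)) / 2 else (f (a, b) + f (b, a)) / 2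

variable {a b : A}

theorem pairExtension_add (f g : A × A → ℝ) (v w : A ⊕ L) :
    pairExtension a b (f + g) v w = pairExtension a b f v w + pairExtension a b g v w := by
  rcases v with x | v <;> rcases w with y | w <;> simp only [pairExtension, Pi.add_apply]
  · ring
  · ring
  · split_ifs <;> ring

theorem pairExtension_smul (c : ℝ) (f : A × A → ℝ) (v w : A ⊕ L) :
    pairExtension a b (c • f) v w = c * pairExtension a b f v w := by
  rcases v with x | v <;> rcases w with y | w <;>
    simp only [pairExtension, Pi.smul_apply, smul_eq_mul]
  · ring
  · ring
  · split_ifs <;> ring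

theorem pairExtension_one (v w : A ⊕ L) : pairExtension a b (fun _ => 1) v w = 1 := by
  rcases v with x | v <;> rcases w with y | w <;> simp [pairExtension]

theorem pairExtension_nonneg {f : A × A → ℝ} (hf : ∀ q, 0 ≤ f q) (v w : A ⊕ L) :
    0 ≤ pairExtension a b f v w := by
  rcases v with x | v <;> rcases w with y | w <;> simp only [pairExtension]
  · exact hf _
  · linarith [hf (x, a), hf (x, b)]
  · linarith [hf (a, y), hf (b, y)]
  · split_ifs
    · linarith [hf (a, a), hf (b, b)]
    · linarith [hf (a, b), hf (b, a)]

theorem abs_pairExtension_le {f : A × A → ℝ} {M : ℝ} {D E : Set A} (haD : a ∈ D) (hbD : b ∈ D)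
    (haE : a ∈ E) (hbE : b ∈ E) (hf : ∀ x ∈ D, ∀ y ∈ E, |f (x, y)| ≤ M) {v w : A ⊕ L}
    (hv : ∀ x, v = .inl x → x ∈ D) (hw : ∀ y, w = .inl y → y ∈ E) :
    |pairExtension a b f v w| ≤ M := by
  have avg : ∀ p q : ℝ, |p| ≤ M → |q| ≤ M → |(p + q) / 2| ≤ M := by
    intro p q hp hq
    rw [abs_le] at *
    constructor <;> linarith [hp.1, hp.2, hq.1, hq.2]
  rcases v with x | v <;> rcases w with y | w <;> simp only [pairExtension]
  · exact hf _ (hv _ rfl) _ (hw _ rfl)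
  · exact avg _ _ (hf _ (hv _ rfl) _ haE) (hf _ (hv _ rfl) _ hbE)
  · exact avg _ _ (hf _ haD _ (hw _ rfl)) (hf _ hbD _ (hw _ rfl))
  · split_ifs
    · exact avg _ _ (hf _ haD _ haE) (hf _ hbD _ hbE)
    · exact avg _ _ (hf _ haD _ hbE) (hf _ hbD _ haE)

theorem IsPseudometric.pairExtension {p : A × A → ℝ} (hp : IsPseudometric p) :
    IsPseudometric (fun q : (A ⊕ L) × (A ⊕ L) => pairExtension a b p q.1 q.2) where
  nonneg v w := pairExtension_nonneg (fun q => hp.nonneg _ _) v w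
  self v := by
    rcases v with x | v <;> simp [_root_.pairExtension, hp.self]
  symm v w := by
    rcases v with x | v <;> rcases w with y | w <;> simp only [_root_.pairExtension]
    · exact hp.symm _ _
    · rw [hp.symm x a, hp.symm x b]
    · rw [hp.symm y a, hp.symm y b]
    · by_cases h : v = w
      · simp [h]
      · simp [h, Ne.symm h]
  triangle u v w := by
    rcases u with x | u <;> rcases v with y | v <;> rcases w with z | w <;>
      simp only [_root_.pairExtension]
    · exact hp.triangle _ _ _
    · linarith [hp.triangle x y a, hp.triangle x y b]
    · linarith [hp.triangle x a z, hp.triangle x b z]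
    · split_ifs
      · linarith [hp.self a, hp.self b]
      · linarith [hp.nonneg a b, hp.symm a b, hp.triangle a x b, hp.triangle x a b,
          hp.triangle x b a]
    · linarith [hp.triangle a y z, hp.triangle b y z]
    · split_ifs
      · linarith [hp.nonneg a y, hp.nonneg b y, hp.nonneg y a, hp.nonneg y b, hp.self a, hp.self b]
      · linarith [hp.triangle a y b, hp.triangle b y a]
    · split_ifs
      · linarith [hp.self a, hp.self b]
      · linarith [hp.nonneg a b, hp.symm a b, hp.triangle a b z, hp.triangle b a z]
    · have := hp.self a
      have := hp.self b
      have := hp.nonneg a b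
      have := hp.nonneg b a
      by_cases h1 : u = v
      · subst h1
        by_cases h2 : u = w <;> simp [h2] <;> linarith
      · by_cases h2 : v = w
        · subst h2
          simp [h1]; linarith
        · by_cases h3 : u = w
          · subst h3
            simp [h1, h2]; linarith
          · simp [h1, h2, h3]; linarith

/-- Against a point x this is the triangle inequality for a, x, b; against another label the value
is p(a, b) itself. All lower bounds for T(p) off X rest on this. -/
theorem IsPseudometric.le_pairExtension_inr_left {p : A × A → ℝ} (hp : IsPseudometric p)
    (w : L) (v : A ⊕ L) (h : v ≠ .inr w) : p (a, b) / 2 ≤ _root_.pairExtension a b p (.inr w) v := by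
  rcases v with x | v <;> simp only [_root_.pairExtension]
  · linarith [hp.triangle a x b, hp.symm b x]
  · rw [if_neg (fun e => h (by rw [e]))]
    linarith [hp.symm a b, hp.nonneg a b]

end PairExtension

/-! ### The operator of a family of random variables -/

/-- A family of random variables, with countably many values each, indexed by `Y`. The values lie
in the disjoint union of `X` and `L`, with finitely many values in `X`, and the random variable at
a point `x` of `X` is the constant `x`. -/
structure RandomExtension {Y : Type*} (X : Set Y) (L Ω : Type*) [MeasurableSpace Ω] where
  /-- The underlying family of random variables. -/
  toFun : Y → Ω → X ⊕ L
  factors : ∀ y, ∃ (ψ : Ω → ℕ) (G : ℕ → X ⊕ L), Measurable ψ ∧ ∀ ω, toFun y ω = G (ψ ω)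
  finite_values : ∀ y, {x | ∃ ω, toFun y ω = .inl x}.Finite
  extends_inl : ∀ (x : X) ω, toFun x ω = .inl x

namespace RandomExtension

variable {Y L Ω : Type*} {X : Set Y} [MeasurableSpace Ω] (Φ : RandomExtension X L Ω)

theorem measurable_comp₂ {B : Type*} [MeasurableSpace B] (g : X ⊕ L → X ⊕ L → B) (y y' : Y) :
    Measurable (fun ω => g (Φ.toFun y ω) (Φ.toFun y' ω)) := by
  obtain ⟨ψ, G, hψ, hG⟩ := Φ.factors y
  obtain ⟨ψ', G', hψ', hG'⟩ := Φ.factors y'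
  have : (fun ω => g (Φ.toFun y ω) (Φ.toFun y' ω)) =
      (fun q : ℕ × ℕ => g (G q.1) (G' q.2)) ∘ fun ω => (ψ ω, ψ' ω) := by
    funext ω; simp [hG, hG']
  rw [this]
  exact (measurable_of_countable _).comp (hψ.prodMk hψ')

theorem measurableSet_rel (r : X ⊕ L → X ⊕ L → Prop) (y y' : Y) :
    MeasurableSet {ω | r (Φ.toFun y ω) (Φ.toFun y' ω)} :=
  measurableSet_setOfPred.2 (Φ.measurable_comp₂ r y y')

/-- The values in `X`, together with two base points. -/
def support (a b : X) (y : Y) : Set X := {x | ∃ ω, Φ.toFun y ω = .inl x} ∪ {a, b}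

variable {a b : X}

theorem finite_support (y : Y) : (Φ.support a b y).Finite :=
  (Φ.finite_values y).union (by simp)

theorem left_mem_support (y : Y) : a ∈ Φ.support a b y := by simp [support]

theorem right_mem_support (y : Y) : b ∈ Φ.support a b y := by simp [support]

theorem mem_support {y : Y} {ω : Ω} {x : X} (h : Φ.toFun y ω = .inl x) : x ∈ Φ.support a b y :=
  Or.inl ⟨ω, h⟩

theorem abs_le_of_support {f : X × X → ℝ} {M : ℝ} {y y' : Y}
    (hf : ∀ x ∈ Φ.support a b y, ∀ x' ∈ Φ.support a b y', |f (x, x')| ≤ M) (ω : Ω) :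
    |pairExtension a b f (Φ.toFun y ω) (Φ.toFun y' ω)| ≤ M :=
  abs_pairExtension_le (Φ.left_mem_support y) (Φ.right_mem_support y) (Φ.left_mem_support y')
    (Φ.right_mem_support y') hf (fun _ h => Φ.mem_support h) (fun _ h => Φ.mem_support h)

theorem exists_bound (f : X × X → ℝ) (y y' : Y) :
    ∃ M, ∀ x ∈ Φ.support a b y, ∀ x' ∈ Φ.support a b y', |f (x, x')| ≤ M := by
  obtain ⟨M, hM⟩ := (((Φ.finite_support (a := a) (b := b) y).prod
    (Φ.finite_support (a := a) (b := b) y')).image (fun q => |f q|)).bddAbove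
  exact ⟨M, fun x hx x' hx' => hM ⟨(x, x'), ⟨hx, hx'⟩, rfl⟩⟩

variable (μ : Measure Ω) [IsProbabilityMeasure μ]

theorem integrable (f : X × X → ℝ) (y y' : Y) :
    Integrable (fun ω => pairExtension a b f (Φ.toFun y ω) (Φ.toFun y' ω)) μ := by
  obtain ⟨M, hM⟩ := Φ.exists_bound (a := a) (b := b) f y y'
  exact Integrable.of_bound (Φ.measurable_comp₂ _ y y').aestronglyMeasurable M
    (Eventually.of_forall fun ω => Φ.abs_le_of_support hM ω)

variable (a b) in
/-- The extension operator defined by a family of random variables. -/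
noncomputable def operator : (X × X → ℝ) →ₗ[ℝ] (Y × Y → ℝ) where
  toFun f q := ∫ ω, pairExtension a b f (Φ.toFun q.1 ω) (Φ.toFun q.2 ω) ∂μ
  map_add' f g := by
    funext q
    simp only [pairExtension_add, Pi.add_apply]
    exact integral_add (Φ.integrable μ f _ _) (Φ.integrable μ g _ _)
  map_smul' c f := by
    funext q
    simp only [pairExtension_smul, Pi.smul_apply, RingHom.id_apply, smul_eq_mul]
    exact integral_const_mul _ _

theorem operator_apply (f : X × X → ℝ) (y y' : Y) : Φ.operator a b μ f (y, y') =
    ∫ ω, pairExtension a b f (Φ.toFun y ω) (Φ.toFun y' ω) ∂μ := rfl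

theorem isExtensionOperator : IsExtensionOperator (Φ.operator a b μ) := by
  intro f x x'
  simp [operator_apply, Φ.extends_inl, pairExtension]

theorem isRegularOperator : IsRegularOperator (Φ.operator a b μ) where
  positive f hf q := integral_nonneg fun ω => pairExtension_nonneg hf _ _
  map_one q := by
    obtain ⟨y, y'⟩ := q
    simp [operator_apply, pairExtension_one]

/-- Only values of f on a product of two finite sets enter the integral. Applied to differences g -
f, this reduces each of the three continuities of the operator to a statement about supports. -/
theorem abs_operator_le {f : X × X → ℝ} {M : ℝ} {y y' : Y}
    (hf : ∀ x ∈ Φ.support a b y, ∀ x' ∈ Φ.support a b y', |f (x, x')| ≤ M) :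
    |Φ.operator a b μ f (y, y')| ≤ M := by
  have := norm_integral_le_of_norm_le_const (μ := μ) (C := M)
    (f := fun ω => pairExtension a b f (Φ.toFun y ω) (Φ.toFun y' ω))
    (Eventually.of_forall fun ω => Φ.abs_le_of_support hf ω)
  simpa [operator_apply] using this

theorem isBoundedFun_operator {f : X × X → ℝ} (hf : IsBoundedFun f) :
    IsBoundedFun (Φ.operator a b μ f) := by
  obtain ⟨M, hM⟩ := hf
  exact ⟨M, fun q => Φ.abs_operator_le μ (fun x _ x' _ => hM _)⟩

theorem isPseudometric_operator {p : X × X → ℝ} (hp : IsPseudometric p) :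
    IsPseudometric (Φ.operator a b μ p) where
  nonneg y y' := integral_nonneg fun ω => hp.pairExtension.nonneg _ _
  self y := by
    rw [operator_apply]
    simp [hp.pairExtension.self (Φ.toFun y _)]
  symm y y' := by
    simp only [operator_apply]
    congr 1 with ω
    exact hp.pairExtension.symm _ _
  triangle x y z := by
    simp only [operator_apply]
    rw [← integral_add (Φ.integrable μ p _ _) (Φ.integrable μ p _ _)]
    exact integral_mono (Φ.integrable μ p _ _)
      ((Φ.integrable μ p _ _).add (Φ.integrable μ p _ _))
      fun ω => hp.pairExtension.triangle _ _ _

/-- A Markov-type bound: the integrand is nonnegative, so the integral over an event is a lower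
bound. -/
theorem le_operator {p : X × X → ℝ} (hp : ∀ q, 0 ≤ p q) {c : ℝ} {S : Set Ω}
    (hS : MeasurableSet S) {y y' : Y}
    (h : ∀ ω ∈ S, c ≤ pairExtension a b p (Φ.toFun y ω) (Φ.toFun y' ω)) :
    c * μ.real S ≤ Φ.operator a b μ p (y, y') := by
  calc c * μ.real S = ∫ ω in S, c ∂μ := by simp [mul_comm]
    _ ≤ ∫ ω in S, pairExtension a b p (Φ.toFun y ω) (Φ.toFun y' ω) ∂μ :=
        setIntegral_mono_on (by simp) (Φ.integrable μ p _ _).integrableOn hS h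
    _ ≤ _ := setIntegral_le_integral (Φ.integrable μ p _ _)
        (Eventually.of_forall fun ω => pairExtension_nonneg hp _ _)

theorem abs_integral_le_of_le_off {g : Ω → ℝ} {S : Set Ω} (hS : MeasurableSet S) {c M : ℝ}
    (hc : 0 ≤ c) (h1 : ∀ ω, |g ω| ≤ M) (h2 : ∀ ω ∉ S, |g ω| ≤ c) :
    |∫ ω, g ω ∂μ| ≤ c + M * μ.real S := by
  have hi : Integrable (fun ω => c + S.indicator (fun _ => M) ω) μ :=
    (integrable_const c).add ((integrable_const M).indicator hS)
  have := norm_integral_le_of_norm_le (μ := μ) (f := g) hi (Eventually.of_forall fun ω => by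
    by_cases hω : ω ∈ S
    · simp only [hω, indicator_of_mem]; exact (h1 ω).trans (by linarith)
    · simp only [hω, not_false_eq_true, indicator_of_notMem, add_zero]; exact h2 ω hω)
  rw [integral_add (integrable_const c) ((integrable_const M).indicator hS),
    integral_indicator hS] at this
  simpa [mul_comm] using this

end RandomExtension

/-! ### Continuity of the operator -/

/-- Closeness in the disjoint union of `A` with a discrete set of labels, where `N` assigns a
neighborhood to each point of `A`. -/
def LabelClose {A L : Type*} (N : A → Set A) : A ⊕ L → A ⊕ L → Prop
  | .inl x, .inl e => x ∈ N e
  | .inr w, .inr e => w = e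
  | _, _ => False

theorem abs_pairExtension_sub_le {A L : Type*} {a b : A} {f : A × A → ℝ} {ε : ℝ} {D E : Set A}
    {N N' : A → Set A} (haD : a ∈ D) (hbD : b ∈ D) (haE : a ∈ E) (hbE : b ∈ E)
    (hN : ∀ e, e ∈ N e) (hN' : ∀ e, e ∈ N' e) (hε : 0 ≤ ε)
    (hf : ∀ e ∈ D, ∀ e' ∈ E, ∀ x ∈ N e, ∀ x' ∈ N' e', |f (x, x') - f (e, e')| ≤ ε)
    {v w v₀ w₀ : A ⊕ L} (hv : LabelClose N v v₀) (hw : LabelClose N' w w₀)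
    (hv₀ : ∀ x, v₀ = .inl x → x ∈ D) (hw₀ : ∀ y, w₀ = .inl y → y ∈ E) :
    |pairExtension a b f v w - pairExtension a b f v₀ w₀| ≤ ε := by
  have avg : ∀ p q r s : ℝ, |p - r| ≤ ε → |q - s| ≤ ε → |(p + q) / 2 - (r + s) / 2| ≤ ε := by
    intro p q r s hp hq
    rw [abs_le] at *
    constructor <;> linarith [hp.1, hp.2, hq.1, hq.2]
  rcases v with x | v <;> rcases v₀ with e | v₀ <;> simp only [LabelClose] at hv <;>
  rcases w with x' | w <;> rcases w₀ with e' | w₀ <;> simp only [LabelClose] at hw <;>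
  simp only [pairExtension]
  · exact hf _ (hv₀ _ rfl) _ (hw₀ _ rfl) _ hv _ hw
  · exact avg _ _ _ _ (hf _ (hv₀ _ rfl) _ haE _ hv _ (hN' _))
      (hf _ (hv₀ _ rfl) _ hbE _ hv _ (hN' _))
  · exact avg _ _ _ _ (hf _ haD _ (hw₀ _ rfl) _ (hN _) _ hw)
      (hf _ hbD _ (hw₀ _ rfl) _ (hN _) _ hw)
  · rw [hv, hw, sub_self, abs_zero]; exact hε

namespace RandomExtension

variable {Y L Ω : Type*} {X : Set Y} [MeasurableSpace Ω] [TopologicalSpace Y]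

/-- Continuity of a family of random variables: the values in `X` are locally finitely many off
`X` and converge at the points of `X`, and the family is continuous in measure. -/
structure IsContinuousFamily (Φ : RandomExtension X L Ω) (μ : Measure Ω) : Prop where
  eventually_finite : ∀ y₀ ∉ X, ∃ D : Set X, D.Finite ∧
    ∀ᶠ y in 𝓝 y₀, ∀ ω x, Φ.toFun y ω = .inl x → x ∈ D
  eventually_mem : ∀ x₀ : X, ∀ U ∈ 𝓝 x₀, ∀ᶠ y in 𝓝 (x₀ : Y), ∀ ω x, Φ.toFun y ω = .inl x → x ∈ U
  tendsto_ne : ∀ y₀ ∉ X, Tendsto (fun y => μ.real {ω | Φ.toFun y ω ≠ Φ.toFun y₀ ω}) (𝓝 y₀) (𝓝 0)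
  tendsto_label : ∀ x₀ : X, Tendsto (fun y => μ.real {ω | ∃ w, Φ.toFun y ω = .inr w})
    (𝓝 (x₀ : Y)) (𝓝 0)

namespace IsContinuousFamily

variable {Φ : RandomExtension X L Ω} {μ : Measure Ω} {a b : X}

theorem tendsto_not_labelClose [IsProbabilityMeasure μ] (h : Φ.IsContinuousFamily μ) (y₀ : Y)
    {N : X → Set X} (hN : ∀ x, N x ∈ 𝓝 x) :
    Tendsto (fun y => μ.real {ω | ¬ LabelClose N (Φ.toFun y ω) (Φ.toFun y₀ ω)}) (𝓝 y₀) (𝓝 0) := by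
  by_cases hy : y₀ ∈ X
  · refine tendsto_of_tendsto_of_tendsto_of_le_of_le' tendsto_const_nhds
      (h.tendsto_label ⟨y₀, hy⟩) (Eventually.of_forall fun _ => measureReal_nonneg) ?_
    filter_upwards [h.eventually_mem ⟨y₀, hy⟩ _ (hN _)] with y hy'
    refine measureReal_mono fun ω hω => ?_
    rcases hv : Φ.toFun y ω with x | w
    · refine absurd ?_ hω
      have := Φ.extends_inl ⟨y₀, hy⟩ ω
      simp only at this
      rw [hv, this]
      exact hy' ω x hv
    · exact ⟨w, hv⟩
  · refine tendsto_of_tendsto_of_tendsto_of_le_of_le tendsto_const_nhds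
      (h.tendsto_ne y₀ hy) (fun _ => measureReal_nonneg) fun y => ?_
    refine measureReal_mono fun ω hω hne => hω ?_
    rw [hne]
    rcases Φ.toFun y₀ ω with x | w
    · exact mem_of_mem_nhds (hN x)
    · rfl

/-- The compact set is the point itself on X, and off X the finite set of values taken nearby. It
allows the two cases to be treated alike. -/
theorem exists_compact (h : Φ.IsContinuousFamily μ) (y₀ : Y) :
    ∃ C : Set X, IsCompact C ∧ ∀ O : Set X, IsOpen O → C ⊆ O →
      ∀ᶠ y in 𝓝 y₀, ∀ ω x, Φ.toFun y ω = .inl x → x ∈ O := by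
  by_cases hy : y₀ ∈ X
  · exact ⟨{⟨y₀, hy⟩}, isCompact_singleton, fun O hO hC =>
      h.eventually_mem ⟨y₀, hy⟩ O (hO.mem_nhds (hC rfl))⟩
  · obtain ⟨D, hD, hD'⟩ := h.eventually_finite y₀ hy
    exact ⟨D, hD.isCompact, fun O _ hC => hD'.mono fun y hy ω x hx => hC (hy ω x hx)⟩

theorem exists_eventually_bound (h : Φ.IsContinuousFamily μ) {f : X × X → ℝ} (hf : Continuous f)
    (y₀ y₀' : Y) : ∃ M, ∀ᶠ q in 𝓝 (y₀, y₀'), ∀ x ∈ Φ.support a b q.1, ∀ x' ∈ Φ.support a b q.2,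
      |f (x, x')| ≤ M := by
  obtain ⟨C, hC, hC'⟩ := h.exists_compact y₀
  obtain ⟨E, hE, hE'⟩ := h.exists_compact y₀'
  have hab : IsCompact ({a, b} : Set X) := (Set.toFinite _).isCompact
  obtain ⟨M, hM⟩ := (((hC.union hab).prod (hE.union hab)).image hf.norm).bddAbove
  -- The bound M on a product of compact sets persists as M + 1 on a product of open neighborhoods,
  -- which contain the supports of all nearby points.
  obtain ⟨u, v, hu, hv, hCu, hEv, huv⟩ := generalized_tube_lemma (hC.union hab) (hE.union hab)
    (isOpen_lt hf.norm (continuous_const (y := M + 1))) (fun q hq =>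
      (hM ⟨q, hq, rfl⟩).trans_lt (lt_add_one M))
  refine ⟨M + 1, ?_⟩
  have h1 := hC' u hu (subset_union_left.trans hCu)
  have h2 := hE' v hv (subset_union_left.trans hEv)
  rw [nhds_prod_eq]
  filter_upwards [h1.prod_mk h2] with q hq x hx x' hx'
  have hxu : x ∈ u := by
    rcases hx with ⟨ω, hω⟩ | hx
    · exact hq.1 ω x hω
    · exact hCu (Or.inr hx)
  have hxv : x' ∈ v := by
    rcases hx' with ⟨ω, hω⟩ | hx
    · exact hq.2 ω x' hω
    · exact hEv (Or.inr hx)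
  exact le_of_lt (huv (mk_mem_prod hxu hxv))

theorem continuous_operator [IsProbabilityMeasure μ] (h : Φ.IsContinuousFamily μ)
    {f : X × X → ℝ} (hf : Continuous f) : Continuous (Φ.operator a b μ f) := by
  rw [continuous_iff_continuousAt]
  rintro ⟨y₀, y₀'⟩
  rw [ContinuousAt, Metric.tendsto_nhds]
  intro ε hε
  obtain ⟨M, hM⟩ := h.exists_eventually_bound (a := a) (b := b) hf y₀ y₀'
  have hM0 := hM.self_of_nhds
  have hMnn : 0 ≤ M := (abs_nonneg _).trans
    (hM0 a (Φ.left_mem_support _) a (Φ.left_mem_support _))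
  have hnb : ∀ e e' : X, ∃ u v : Set X, u ∈ 𝓝 e ∧ v ∈ 𝓝 e' ∧
      ∀ x ∈ u, ∀ x' ∈ v, |f (x, x') - f (e, e')| ≤ ε / 2 := by
    intro e e'
    have := (Metric.tendsto_nhds.1 (hf.tendsto (e, e'))) (ε / 2) (by positivity)
    rw [nhds_prod_eq, eventually_prod_iff] at this
    obtain ⟨pu, hu, pv, hv, huv⟩ := this
    exact ⟨{x | pu x}, {x | pv x}, hu, hv, fun x hx x' hx' => (huv hx hx').le⟩
  choose u v hu hv huv using hnb
  set D := Φ.support a b y₀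
  set E := Φ.support a b y₀'
  have hD : D.Finite := Φ.finite_support y₀
  have hE : E.Finite := Φ.finite_support y₀'
  -- The supports at the base points are finite, so finite intersections give neighborhoods that
  -- serve all pairs of their elements at once.
  let N : X → Set X := fun e => ⋂ e' ∈ E, u e e'
  let N' : X → Set X := fun e' => ⋂ e ∈ D, v e e'
  have hN : ∀ e, N e ∈ 𝓝 e := fun e => (biInter_mem hE).2 fun e' _ => hu e e'
  have hN' : ∀ e, N' e ∈ 𝓝 e := fun e => (biInter_mem hD).2 fun e' _ => hv e' e
  have ht1 := h.tendsto_not_labelClose y₀ hN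
  have ht2 := h.tendsto_not_labelClose y₀' hN'
  -- Off the event that one of the two values is not close, the integrand moves by at most ε / 2; on
  -- it, by at most M + M, and its probability tends to 0.
  have ht : Tendsto (fun q : Y × Y =>
      (ε / 2) + (M + M) * (μ.real {ω | ¬ LabelClose N (Φ.toFun q.1 ω) (Φ.toFun y₀ ω)} +
        μ.real {ω | ¬ LabelClose N' (Φ.toFun q.2 ω) (Φ.toFun y₀' ω)})) (𝓝 (y₀, y₀'))
      (𝓝 (ε / 2 + (M + M) * (0 + 0))) := by
    rw [nhds_prod_eq]
    exact tendsto_const_nhds.add (tendsto_const_nhds.mul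
      ((ht1.comp tendsto_fst).add (ht2.comp tendsto_snd)))
  filter_upwards [hM, ht.eventually_lt_const (by linarith : _ < ε)] with q hq hlt
  obtain ⟨y, y'⟩ := q
  rw [Real.dist_eq, operator_apply, operator_apply,
    ← integral_sub (Φ.integrable μ f _ _) (Φ.integrable μ f _ _)]
  set S := {ω | ¬ LabelClose N (Φ.toFun y ω) (Φ.toFun y₀ ω)}
  set S' := {ω | ¬ LabelClose N' (Φ.toFun y' ω) (Φ.toFun y₀' ω)}
  have hS : MeasurableSet S := Φ.measurableSet_rel (fun v w => ¬ LabelClose N v w) y y₀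
  have hS' : MeasurableSet S' := Φ.measurableSet_rel (fun v w => ¬ LabelClose N' v w) y' y₀'
  refine (abs_integral_le_of_le_off μ (hS.union hS') (c := ε / 2) (M := M + M) (by positivity)
    (fun ω => ?_) (fun ω hω => ?_)).trans_lt (lt_of_le_of_lt ?_ hlt)
  · exact (abs_sub _ _).trans
      (add_le_add (Φ.abs_le_of_support hq ω) (Φ.abs_le_of_support hM0 ω))
  · simp only [S, S', mem_union, mem_ofPred_eq, not_or, not_not] at hω
    exact abs_pairExtension_sub_le (D := D) (E := E) (Φ.left_mem_support _)
      (Φ.right_mem_support _) (Φ.left_mem_support _) (Φ.right_mem_support _)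
      (fun e => mem_of_mem_nhds (hN e)) (fun e => mem_of_mem_nhds (hN' e)) (by positivity)
      (fun e he e' he' x hx x' hx' => huv e e' x (mem_iInter₂.1 hx e' he') x'
        (mem_iInter₂.1 hx' e he)) hω.1 hω.2 (fun x hx => Φ.mem_support hx)
      (fun x hx => Φ.mem_support hx)
  · have := measureReal_union_le (μ := μ) S S'
    gcongr

/-- Outside any open set containing K ∩ X, only finitely many points of X occur as values over K or
as base points. A finite subcover of K ∩ X therefore leaves finitely many points to cover. -/
theorem exists_compact_support (h : Φ.IsContinuousFamily μ) (hX : IsClosed X) {K : Set Y}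
    (hK : IsCompact K) : ∃ C : Set X, IsCompact C ∧ ∀ y ∈ K, Φ.support a b y ⊆ C := by
  have hKX : IsCompact ((↑) ⁻¹' K : Set X) := hX.isClosedEmbedding_subtypeVal.isCompact_preimage hK
  refine ⟨(↑) ⁻¹' K ∪ ⋃ y ∈ K, Φ.support a b y, ?_, fun y hy =>
    subset_union_of_subset_right (subset_biUnion_of_mem hy) _⟩
  have key : ∀ O : Set X, IsOpen O → (↑) ⁻¹' K ⊆ O →
      ((⋃ y ∈ K, Φ.support a b y) \ O).Finite := by
    intro O hO hKO
    have hloc : ∀ y ∈ K, ∃ t ∈ 𝓝[K] y, ((⋃ y ∈ t, Φ.support a b y) \ O).Finite := by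
      intro y hy
      have hab : ({a, b} : Set X).Finite := Set.toFinite _
      by_cases hyX : y ∈ X
      · refine ⟨_, mem_nhdsWithin_of_mem_nhds (h.eventually_mem ⟨y, hyX⟩ O
          (hO.mem_nhds (hKO hy))), hab.subset ?_⟩
        rintro x ⟨hx, hxO⟩
        obtain ⟨z, hz, ⟨ω, hω⟩ | hx⟩ := mem_iUnion₂.1 hx
        · exact absurd (hz ω x hω) hxO
        · exact hx
      · obtain ⟨D, hD, hD'⟩ := h.eventually_finite y hyX
        refine ⟨_, mem_nhdsWithin_of_mem_nhds hD', (hD.union hab).subset ?_⟩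
        rintro x ⟨hx, hxO⟩
        obtain ⟨z, hz, ⟨ω, hω⟩ | hx⟩ := mem_iUnion₂.1 hx
        · exact Or.inl (hz ω x hω)
        · exact Or.inr hx
    refine hK.induction_on (p := fun t => ((⋃ y ∈ t, Φ.support a b y) \ O).Finite) (by simp)
      (fun s t hst ht => ht.subset (sdiff_subset_sdiff_left (biUnion_mono hst fun _ _ => le_rfl)))
      (fun s t hs ht => ?_) hloc
    rw [biUnion_union, union_sdiff_distrib]
    exact hs.union ht
  rw [isCompact_iff_finite_subcover]
  intro ι U hU hcov
  obtain ⟨t, ht⟩ := hKX.elim_finite_subcover U hU (subset_union_left.trans hcov)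
  have hfin := key (⋃ i ∈ t, U i) (isOpen_biUnion fun i _ => hU i) ht
  obtain ⟨t', ht'⟩ := hfin.isCompact.elim_finite_subcover U hU
    (sdiff_subset.trans (subset_union_right.trans hcov))
  classical
  refine ⟨t ∪ t', union_subset (ht.trans ?_) fun x hx => ?_⟩
  · exact biUnion_mono (fun i hi => Finset.mem_union_left _ hi) fun _ _ => le_rfl
  · by_cases hxO : x ∈ ⋃ i ∈ t, U i
    · exact biUnion_mono (fun i hi => Finset.mem_union_left _ hi) (fun _ _ => le_rfl) hxO
    · exact biUnion_mono (fun i hi => Finset.mem_union_right _ hi) (fun _ _ => le_rfl)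
        (ht' ⟨hx, hxO⟩)

theorem isTricontinuous_operator [IsProbabilityMeasure μ] (h : Φ.IsContinuousFamily μ)
    (hX : IsClosed X) : IsTricontinuous (Φ.operator a b μ) where
  pointwise := by
    refine continuous_pi fun q => continuous_iff_continuousAt.2 fun f => ?_
    obtain ⟨y, y'⟩ := q
    rw [ContinuousAt, Metric.tendsto_nhds]
    intro ε hε
    have hfin := (Φ.finite_support (a := a) (b := b) y).prod (Φ.finite_support (a := a) (b := b) y')
    have : ∀ᶠ g : X × X → ℝ in 𝓝 f, ∀ q ∈ Φ.support a b y ×ˢ Φ.support a b y',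
        |g q - f q| < ε / 2 := by
      rw [eventually_all_finite hfin]
      intro q _
      exact (Metric.tendsto_nhds.1 ((continuous_apply q).tendsto f)) (ε / 2) (by positivity)
    filter_upwards [this] with g hg
    rw [Real.dist_eq, ← Pi.sub_apply, ← map_sub]
    exact (Φ.abs_operator_le μ fun x hx x' hx' => (hg (x, x') ⟨hx, hx'⟩).le).trans_lt (by linarith)
  uniform := by
    refine continuous_iff_continuousAt.2 fun f => ?_
    have hid := (UniformFun.tendsto_iff_tendstoUniformly (F := id) (f := f)).1 tendsto_id
    rw [ContinuousAt, UniformFun.tendsto_iff_tendstoUniformly]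
    rw [Metric.tendstoUniformly_iff] at hid ⊢
    intro ε hε
    filter_upwards [hid (ε / 2) (by positivity)] with g hg
    rintro ⟨y, y'⟩
    simp only [Function.comp_apply, UniformFun.toFun_ofFun, Real.dist_eq]
    rw [← Pi.sub_apply, ← map_sub]
    exact (Φ.abs_operator_le μ fun x _ x' _ => (hg (x, x')).le).trans_lt (by linarith)
  compactOpen := by
    refine continuous_iff_continuousAt.2 fun f => ?_
    have hid := (UniformOnFun.tendsto_iff_tendstoUniformlyOn (F := id) (f := f)).1 tendsto_id
    rw [ContinuousAt, UniformOnFun.tendsto_iff_tendstoUniformlyOn]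
    intro K hK
    obtain ⟨C, hC, hKC⟩ := h.exists_compact_support (a := a) (b := b) hX (hK.image continuous_fst)
    obtain ⟨C', hC', hKC'⟩ :=
      h.exists_compact_support (a := a) (b := b) hX (hK.image continuous_snd)
    have hid := hid (C ×ˢ C') (hC.prod hC')
    rw [Metric.tendstoUniformlyOn_iff] at hid ⊢
    intro ε hε
    filter_upwards [hid (ε / 2) (by positivity)] with g hg
    rintro ⟨y, y'⟩ hy
    simp only [Function.comp_apply, UniformOnFun.toFun_ofFun, Real.dist_eq]
    rw [← Pi.sub_apply, ← map_sub]
    exact (Φ.abs_operator_le μ fun x hx x' hx' => (hg (x, x') ⟨hKC y ⟨_, hy, rfl⟩ hx,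
      hKC' y' ⟨_, hy, rfl⟩ hx'⟩).le).trans_lt (by linarith)

end IsContinuousFamily

end RandomExtension

/-! ### Selection systems: the first weight above a threshold -/

/-- A sequence of continuous weights with locally constant values, such that at each point some
weight exceeds `1`. -/
structure SelectionSystem (Z A : Type*) [TopologicalSpace Z] where
  /-- The weights. -/
  weight : ℕ → Z → ℝ
  /-- The values, which are only relevant where the weight is positive. -/
  value : ℕ → Z → A
  continuous_weight : ∀ k, Continuous (weight k)
  eventually_value : ∀ k z₀, ∀ᶠ z in 𝓝 z₀, weight k z ≤ 0 ∨ value k z = value k z₀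
  exists_one_lt : ∀ z, ∃ k, 1 < weight k z

theorem unitInterval.volume_real_not_iff_le (u v : ℝ) :
    (volume : Measure I).real {t | ¬ ((t : ℝ) < u ↔ (t : ℝ) < v)} ≤ |u - v| := by
  rw [measureReal_def]
  refine ENNReal.toReal_le_of_le_ofReal (abs_nonneg _) ?_
  rw [unitInterval.volume_apply, abs_sub_comm, ← Real.volume_interval]
  refine measure_mono ?_
  rintro _ ⟨t, ht, rfl⟩
  rw [mem_uIcc]
  by_cases h : (t : ℝ) < u
  · have : ¬ (t : ℝ) < v := fun h' => ht (iff_of_true h h')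
    exact Or.inr ⟨not_lt.1 this, h.le⟩
  · have : (t : ℝ) < v := by
      by_contra h'
      exact ht (iff_of_false h h')
    exact Or.inl ⟨not_lt.1 h, this.le⟩

theorem unitInterval.volume_real_lt {c : ℝ} (h0 : 0 ≤ c) (h1 : c ≤ 1) :
    (volume : Measure I).real {t | (t : ℝ) < c} = c := by
  have := unitInterval.volume_Iio ⟨c, h0, h1⟩
  rw [measureReal_def]
  change (volume (Iio (⟨c, h0, h1⟩ : I))).toReal = c
  rw [this, ENNReal.toReal_ofReal h0]

namespace SelectionSystem

variable {Z A : Type*} [TopologicalSpace Z] (τ : SelectionSystem Z A)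

theorem exists_lt (z : Z) (t : I) : ∃ k, (t : ℝ) < τ.weight k z := by
  obtain ⟨k, hk⟩ := τ.exists_one_lt z
  exact ⟨k, t.2.2.trans_lt hk⟩

open scoped Classical in
/-- The first index at which the weight exceeds `t`. -/
noncomputable def index (z : Z) (t : I) : ℕ := Nat.find (τ.exists_lt z t)

/-- The value at the first index at which the weight exceeds `t`. -/
noncomputable def select (z : Z) (t : I) : A := τ.value (τ.index z t) z

theorem lt_weight_index (z : Z) (t : I) : (t : ℝ) < τ.weight (τ.index z t) z := by
  classical
  exact Nat.find_spec (τ.exists_lt z t)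

theorem weight_index_pos (z : Z) (t : I) : 0 < τ.weight (τ.index z t) z :=
  t.2.1.trans_lt (τ.lt_weight_index z t)

theorem index_le {z : Z} {t : I} {k : ℕ} (h : (t : ℝ) < τ.weight k z) : τ.index z t ≤ k := by
  classical
  exact Nat.find_min' _ h

theorem index_le_of_one_lt {z : Z} {k : ℕ} (h : 1 < τ.weight k z) (t : I) : τ.index z t ≤ k :=
  τ.index_le (t.2.2.trans_lt h)

theorem index_congr {z z' : Z} {t t' : I}
    (h : ∀ k ≤ max (τ.index z t) (τ.index z' t'),
      ((t : ℝ) < τ.weight k z ↔ (t' : ℝ) < τ.weight k z')) :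
    τ.index z t = τ.index z' t' :=
  le_antisymm (τ.index_le ((h _ (le_max_right _ _)).2 (τ.lt_weight_index z' t')))
    (τ.index_le ((h _ (le_max_left _ _)).1 (τ.lt_weight_index z t)))

theorem measurable_index (z : Z) : Measurable (τ.index z) := by
  classical
  exact measurable_find (τ.exists_lt z) fun k => measurableSet_lt measurable_subtype_coe
    measurable_const

theorem exists_eventually_select_mem (z₀ : Z) :
    ∃ D : Set A, D.Finite ∧ ∀ᶠ z in 𝓝 z₀, ∀ t, τ.select z t ∈ D := by
  obtain ⟨K, hK⟩ := τ.exists_one_lt z₀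
  refine ⟨(fun k => τ.value k z₀) '' Iic K, (finite_Iic K).image _, ?_⟩
  have h1 : ∀ᶠ z in 𝓝 z₀, 1 < τ.weight K z :=
    ((τ.continuous_weight K).tendsto z₀).eventually_const_lt hK
  have h2 : ∀ᶠ z in 𝓝 z₀, ∀ k ∈ Iic K, τ.weight k z ≤ 0 ∨ τ.value k z = τ.value k z₀ :=
    (eventually_all_finite (finite_Iic K)).2 fun k _ => τ.eventually_value k z₀
  filter_upwards [h1, h2] with z hz1 hz2 t
  have hle := τ.index_le_of_one_lt hz1 t
  exact ⟨_, hle, ((hz2 _ hle).resolve_left (not_le.2 (τ.weight_index_pos z t))).symm⟩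

/-- Near z₀ only the indices up to some K matter, and their values are locally constant where the
weight is positive. The selection can change only if t lies between the weights of some k ≤ K at z
and at z₀, which has measure at most the sum of their differences. -/
theorem tendsto_select_ne (z₀ : Z) :
    Tendsto (fun z => (volume : Measure I).real {t | τ.select z t ≠ τ.select z₀ t})
      (𝓝 z₀) (𝓝 0) := by
  obtain ⟨K, hK⟩ := τ.exists_one_lt z₀
  have h1 : ∀ᶠ z in 𝓝 z₀, 1 < τ.weight K z :=
    ((τ.continuous_weight K).tendsto z₀).eventually_const_lt hK
  have h2 : ∀ᶠ z in 𝓝 z₀, ∀ k ∈ Iic K, τ.weight k z ≤ 0 ∨ τ.value k z = τ.value k z₀ :=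
    (eventually_all_finite (finite_Iic K)).2 fun k _ => τ.eventually_value k z₀
  have ht : Tendsto (fun z => ∑ k ∈ Finset.range (K + 1), |τ.weight k z - τ.weight k z₀|)
      (𝓝 z₀) (𝓝 0) := by
    have : Continuous (fun z => ∑ k ∈ Finset.range (K + 1), |τ.weight k z - τ.weight k z₀|) :=
      continuous_finsetSum _ fun k _ => ((τ.continuous_weight k).sub continuous_const).abs
    simpa using this.tendsto z₀
  refine tendsto_of_tendsto_of_tendsto_of_le_of_le' tendsto_const_nhds ht
    (Eventually.of_forall fun _ => measureReal_nonneg) ?_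
  filter_upwards [h1, h2] with z hz1 hz2
  calc (volume : Measure I).real {t | τ.select z t ≠ τ.select z₀ t}
      ≤ (volume : Measure I).real (⋃ k ∈ Finset.range (K + 1),
          {t : I | ¬ ((t : ℝ) < τ.weight k z ↔ (t : ℝ) < τ.weight k z₀)}) := by
        refine measureReal_mono (fun t ht => ?_) (measure_ne_top _ _)
        by_contra hcon
        simp only [mem_iUnion, Finset.mem_range, not_exists] at hcon
        have hle := τ.index_le_of_one_lt hz1 t
        have hle0 := τ.index_le_of_one_lt hK t
        have hidx : τ.index z t = τ.index z₀ t := τ.index_congr fun k hk =>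
          not_not.1 (hcon k (by omega))
        refine ht ?_
        rw [select, select, ← hidx]
        exact (hz2 _ hle).resolve_left (not_le.2 (τ.weight_index_pos z t))
    _ ≤ ∑ k ∈ Finset.range (K + 1), (volume : Measure I).real
          {t : I | ¬ ((t : ℝ) < τ.weight k z ↔ (t : ℝ) < τ.weight k z₀)} :=
        measureReal_biUnion_finset_le _ _
    _ ≤ _ := Finset.sum_le_sum fun k _ => unitInterval.volume_real_not_iff_le _ _

end SelectionSystem

/-! ### Random variables on ℕ × [0,1] -/

/-- The data from which an extension operator is built: a function `scale` vanishing exactly on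
`X`, a selection system off `X` with values in `X`, converging at the points of `X`, and a sequence
of selection systems off `X` with values in a set of labels. -/
structure ExtensionData {Y : Type*} [TopologicalSpace Y] (X : Set Y) (L : Type*) where
  /-- The proportion of labels. -/
  scale : Y → ℝ
  /-- The selection of points of `X`. -/
  main : SelectionSystem (Xᶜ : Set Y) X
  /-- The selections of labels. -/
  label : ℕ → SelectionSystem (Xᶜ : Set Y) L
  continuous_scale : Continuous scale
  scale_le_one : ∀ y, scale y ≤ 1
  scale_eq_zero : ∀ y ∈ X, scale y = 0
  scale_pos : ∀ y ∉ X, 0 < scale y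
  eventually_main : ∀ x : X, ∀ U ∈ 𝓝 x, ∀ᶠ y in 𝓝 (x : Y), ∀ (hy : y ∉ X) k,
    0 < main.weight k ⟨y, hy⟩ → main.value k ⟨y, hy⟩ ∈ U

theorem eventually_nhds_of_subtype_compl {Y : Type*} [TopologicalSpace Y] {X : Set Y}
    (hX : IsClosed X) {P : (Xᶜ : Set Y) → Prop} (z₀ : (Xᶜ : Set Y)) (h : ∀ᶠ z in 𝓝 z₀, P z) :
    ∀ᶠ y in 𝓝 (z₀ : Y), ∃ hy : y ∉ X, P ⟨y, hy⟩ := by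
  rw [← hX.isOpen_compl.isOpenEmbedding_subtypeVal.map_nhds_eq z₀, eventually_map]
  exact h.mono fun z hz => ⟨z.2, hz⟩

namespace ExtensionData

variable {Y L : Type*} [TopologicalSpace Y] {X : Set Y} (d : ExtensionData X L)

open scoped Classical in
/-- The family of random variables on `ℕ × I` defined by the data. -/
noncomputable def value (y : Y) (ω : ℕ × I) : X ⊕ L :=
  if hy : y ∈ X then .inl ⟨y, hy⟩
  else if (ω.2 : ℝ) < d.scale y then .inr ((d.label ω.1).select ⟨y, hy⟩ ω.2)
  else .inl (d.main.select ⟨y, hy⟩ ω.2)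

theorem value_of_mem (x : X) (ω : ℕ × I) : d.value x ω = .inl x := by
  simp [value]

theorem value_of_lt (z : (Xᶜ : Set Y)) {ω : ℕ × I} (h : (ω.2 : ℝ) < d.scale z) :
    d.value z ω = .inr ((d.label ω.1).select z ω.2) := by
  have hz : (z : Y) ∉ X := z.2
  simp [value, hz, h]

theorem value_of_not_lt (z : (Xᶜ : Set Y)) {ω : ℕ × I} (h : ¬ (ω.2 : ℝ) < d.scale z) :
    d.value z ω = .inl (d.main.select z ω.2) := by
  have hz : (z : Y) ∉ X := z.2
  simp [value, hz, h]

theorem exists_select_of_value_eq_inl (z : (Xᶜ : Set Y)) {ω : ℕ × I} {x : X}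
    (h : d.value z ω = .inl x) : d.main.select z ω.2 = x := by
  by_cases hlt : (ω.2 : ℝ) < d.scale z
  · rw [d.value_of_lt z hlt] at h
    cases h
  · rw [d.value_of_not_lt z hlt] at h
    exact Sum.inl.inj h

theorem lt_scale_of_value_eq_inr {y : Y} {ω : ℕ × I} {w : L} (h : d.value y ω = .inr w) :
    (ω.2 : ℝ) < d.scale y := by
  by_cases hy : y ∈ X
  · have := d.value_of_mem ⟨y, hy⟩ ω
    simp only at this
    rw [this] at h
    cases h
  · by_contra hlt
    have := d.value_of_not_lt ⟨y, hy⟩ hlt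
    simp only at this
    rw [this] at h
    cases h

/-- The family of random variables defined by the data, as a `RandomExtension`. -/
noncomputable def toRandomExtension : RandomExtension X L (ℕ × I) where
  toFun := d.value
  factors y := by
    classical
    by_cases hy : y ∈ X
    · exact ⟨fun _ => 0, fun _ => .inl ⟨y, hy⟩, measurable_const, fun ω => d.value_of_mem ⟨y, hy⟩ ω⟩
    · let z : (Xᶜ : Set Y) := ⟨y, hy⟩
      let ψ : ℕ × I → ℕ × ℕ × ℕ × Bool := fun ω =>
        (ω.1, d.main.index z ω.2, (d.label ω.1).index z ω.2,
          if (ω.2 : ℝ) < d.scale y then true else false)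
      have hψ : Measurable ψ := by
        refine measurable_fst.prodMk (Measurable.prodMk ?_ (Measurable.prodMk ?_ ?_))
        · exact (d.main.measurable_index z).comp measurable_snd
        · exact measurable_from_prod_countable_right fun m => (d.label m).measurable_index z
        · exact Measurable.ite (measurableSet_lt
            (measurable_subtype_coe.comp measurable_snd) measurable_const) measurable_const
            measurable_const
      let G : ℕ × ℕ × ℕ × Bool → X ⊕ L := fun q =>
        if q.2.2.2 = true then .inr ((d.label q.1).value q.2.2.1 z)
        else .inl (d.main.value q.2.1 z)
      refine ⟨fun ω => Encodable.encode (ψ ω),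
        fun n => G ((Encodable.decode n).getD (0, 0, 0, false)),
        (measurable_of_countable _).comp hψ, fun ω => ?_⟩
      simp only [Encodable.encodek, Option.getD_some, G, ψ]
      by_cases h : (ω.2 : ℝ) < d.scale y <;> simp only [h, if_true, if_false, Bool.false_eq_true]
      · exact d.value_of_lt z h
      · exact d.value_of_not_lt z h
  finite_values y := by
    by_cases hy : y ∈ X
    · refine (finite_singleton (⟨y, hy⟩ : X)).subset ?_
      rintro x ⟨ω, hω⟩
      rw [d.value_of_mem ⟨y, hy⟩ ω] at hω
      exact (Sum.inl.inj hω).symm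
    · obtain ⟨D, hD, hD'⟩ := d.main.exists_eventually_select_mem ⟨y, hy⟩
      refine hD.subset ?_
      rintro x ⟨ω, hω⟩
      rw [← d.exists_select_of_value_eq_inl ⟨y, hy⟩ hω]
      exact hD'.self_of_nhds _
  extends_inl := d.value_of_mem

variable (ν : Measure ℕ) [IsProbabilityMeasure ν]

theorem exists_measureReal_Ici_lt {ε : ℝ} (hε : 0 < ε) : ∃ J, ν.real (Ici J) < ε := by
  have h : Tendsto (fun J : ℕ => ν (Ici J)) atTop (𝓝 (ν (⋂ J : ℕ, Ici J))) :=
    tendsto_measure_iInter_atTop (fun J => measurableSet_Ici.nullMeasurableSet)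
      (fun i j hij => Ici_subset_Ici.2 hij) ⟨0, measure_ne_top _ _⟩
  have hemp : (⋂ J : ℕ, Ici J) = ∅ := by
    ext n
    simp only [mem_iInter, mem_Ici, mem_empty_iff_false, iff_false, not_forall, not_le]
    exact ⟨n + 1, Nat.lt_succ_self n⟩
  rw [hemp, measure_empty] at h
  obtain ⟨J, hJ⟩ := (h.eventually_lt_const (ENNReal.ofReal_pos.2 hε)).exists
  refine ⟨J, ?_⟩
  rw [measureReal_def]
  exact (ENNReal.lt_ofReal_iff_toReal_lt (measure_ne_top _ _)).1 hJ

theorem measureReal_univ_prod (S : Set I) : (ν.prod volume).real (univ ×ˢ S) =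
    (volume : Measure I).real S := by
  rw [measureReal_prod_prod]; simp

theorem isContinuousFamily (hX : IsClosed X) :
    d.toRandomExtension.IsContinuousFamily (ν.prod volume) where
  eventually_finite y₀ hy₀ := by
    obtain ⟨D, hD, hD'⟩ := d.main.exists_eventually_select_mem ⟨y₀, hy₀⟩
    refine ⟨D, hD, (eventually_nhds_of_subtype_compl hX _ hD').mono ?_⟩
    rintro y ⟨hy, h⟩ ω x hx
    rw [← d.exists_select_of_value_eq_inl ⟨y, hy⟩ hx]
    exact h _
  eventually_mem x₀ U hU := by
    obtain ⟨u, hu, huU⟩ := mem_nhds_subtype _ _ _ |>.1 hU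
    filter_upwards [d.eventually_main x₀ U hU, hu] with y hy hyu ω x hx
    by_cases hyX : y ∈ X
    · have h := d.value_of_mem ⟨y, hyX⟩ ω
      simp only at h
      rw [← Sum.inl.inj (h.symm.trans hx)]
      exact huU hyu
    · rw [← d.exists_select_of_value_eq_inl ⟨y, hyX⟩ hx]
      exact hy hyX _ (d.main.weight_index_pos _ _)
  tendsto_ne y₀ hy₀ := by
    rw [Metric.tendsto_nhds]
    intro ε hε
    -- Infinitely many label systems cannot be controlled simultaneously, so those with index at
    -- least J are discarded at the cost of a small tail of ν.
    obtain ⟨J, hJ⟩ := exists_measureReal_Ici_lt ν (half_pos hε)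
    let z₀ : (Xᶜ : Set Y) := ⟨y₀, hy₀⟩
    have ht : Tendsto (fun z : (Xᶜ : Set Y) => |d.scale z - d.scale z₀| +
        (volume : Measure I).real {t | d.main.select z t ≠ d.main.select z₀ t} +
        ∑ m ∈ Finset.range J,
          (volume : Measure I).real {t | (d.label m).select z t ≠ (d.label m).select z₀ t})
        (𝓝 z₀) (𝓝 (0 + 0 + ∑ m ∈ Finset.range J, 0)) := by
      refine (Tendsto.add ?_ (d.main.tendsto_select_ne z₀)).add
        (tendsto_finsetSum _ fun m _ => (d.label m).tendsto_select_ne z₀)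
      have : Continuous fun z : (Xᶜ : Set Y) => |d.scale z - d.scale z₀| :=
        ((d.continuous_scale.comp continuous_subtype_val).sub continuous_const).abs
      simpa using this.tendsto z₀
    have := ht.eventually_lt_const (by simpa using half_pos hε : _ < ε / 2)
    refine (eventually_nhds_of_subtype_compl hX _ this).mono ?_
    rintro y ⟨hy, hlt⟩
    let z : (Xᶜ : Set Y) := ⟨y, hy⟩
    rw [Real.dist_eq, sub_zero, abs_of_nonneg measureReal_nonneg]
    let S1 : Set I := {t | ¬ ((t : ℝ) < d.scale z ↔ (t : ℝ) < d.scale z₀)}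
    let S2 : Set I := {t | d.main.select z t ≠ d.main.select z₀ t}
    let S3 : ℕ → Set I := fun m => {t | (d.label m).select z t ≠ (d.label m).select z₀ t}
    have hsub : {ω | d.toRandomExtension.toFun y ω ≠ d.toRandomExtension.toFun y₀ ω} ⊆
        univ ×ˢ S1 ∪ univ ×ˢ S2 ∪ (⋃ m ∈ Finset.range J, univ ×ˢ S3 m) ∪ Ici J ×ˢ univ := by
      rintro ⟨m, t⟩ hne
      by_contra hcon
      simp only [mem_union, mem_prod, mem_univ, true_and, and_true, mem_iUnion, Finset.mem_range,
        not_or, not_exists, mem_Ici, not_le, S1, S2, S3, mem_ofPred_eq, not_not] at hcon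
      obtain ⟨⟨⟨h1, h2⟩, h3⟩, h4⟩ := hcon
      refine hne ?_
      change d.value z (m, t) = d.value z₀ (m, t)
      by_cases hs : (t : ℝ) < d.scale z
      · rw [d.value_of_lt z hs, d.value_of_lt z₀ (h1.1 hs)]
        exact congrArg _ (h3 m h4)
      · rw [d.value_of_not_lt z hs, d.value_of_not_lt z₀ (fun h => hs (h1.2 h))]
        exact congrArg _ h2
    have h1 := measureReal_mono (μ := ν.prod (volume : Measure I)) hsub
    have h2 := measureReal_union_le (μ := ν.prod (volume : Measure I))
      (univ ×ˢ S1 ∪ univ ×ˢ S2 ∪ (⋃ m ∈ Finset.range J, univ ×ˢ S3 m)) (Ici J ×ˢ univ)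
    have h3 := measureReal_union_le (μ := ν.prod (volume : Measure I))
      (univ ×ˢ S1 ∪ univ ×ˢ S2) (⋃ m ∈ Finset.range J, univ ×ˢ S3 m)
    have h4 := measureReal_union_le (μ := ν.prod (volume : Measure I)) (univ ×ˢ S1) (univ ×ˢ S2)
    have h5 := measureReal_biUnion_finset_le (μ := ν.prod (volume : Measure I))
      (Finset.range J) (fun m => univ ×ˢ S3 m)
    simp only [measureReal_univ_prod] at h4 h5
    have h6 : (ν.prod (volume : Measure I)).real (Ici J ×ˢ univ) = ν.real (Ici J) := by
      rw [measureReal_prod_prod]; simp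
    have h7 : (volume : Measure I).real S1 ≤ |d.scale z - d.scale z₀| :=
      unitInterval.volume_real_not_iff_le _ _
    change |d.scale z - d.scale z₀| + (volume : Measure I).real S2 +
      ∑ m ∈ Finset.range J, (volume : Measure I).real (S3 m) < ε / 2 at hlt
    linarith
  tendsto_label x₀ := by
    have h0 : Tendsto d.scale (𝓝 (x₀ : Y)) (𝓝 0) := by
      have := d.continuous_scale.tendsto (x₀ : Y)
      rwa [d.scale_eq_zero x₀ x₀.2] at this
    refine tendsto_of_tendsto_of_tendsto_of_le_of_le tendsto_const_nhds h0
      (fun _ => measureReal_nonneg) fun y => ?_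
    have hnn : 0 ≤ d.scale y := by
      by_cases hy : y ∈ X
      · exact (d.scale_eq_zero y hy).ge
      · exact (d.scale_pos y hy).le
    calc _ ≤ (ν.prod (volume : Measure I)).real (univ ×ˢ {t : I | (t : ℝ) < d.scale y}) :=
          measureReal_mono fun ω hω => by
            obtain ⟨w, hw⟩ := hω
            exact ⟨trivial, d.lt_scale_of_value_eq_inr hw⟩
      _ = d.scale y := by
          rw [measureReal_univ_prod, unitInterval.volume_real_lt hnn (d.scale_le_one y)]

end ExtensionData

/-! ### Metrics and dominating metrics -/

namespace ExtensionData

variable {Y L : Type*} [TopologicalSpace Y] {X : Set Y} (d : ExtensionData X L)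
  (ν : Measure ℕ) [IsProbabilityMeasure ν] {a b : X}

variable (a b) in
/-- The extension operator defined by the data. -/
noncomputable def extensionOperator : (X × X → ℝ) →ₗ[ℝ] (Y × Y → ℝ) :=
  d.toRandomExtension.operator a b (ν.prod volume)

/-- On the event {m} × [0, c) the value at z is a label, and the value at y is a point of X or a
different label. The event has probability ν{m} · c. -/
theorem le_extensionOperator {p : X × X → ℝ} (hp : IsPseudometric p) (z : (Xᶜ : Set Y)) (y : Y)
    (m : ℕ) {c : ℝ} (hc : 0 ≤ c) (hcs : c ≤ d.scale z)
    (h : ∀ t : I, (t : ℝ) < c → ∀ hy : y ∉ X,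
      (d.label m).select z t ≠ (d.label m).select ⟨y, hy⟩ t) :
    p (a, b) / 2 * (ν.real {m} * c) ≤ d.extensionOperator ν a b p (z, y) := by
  have hS : (ν.prod (volume : Measure I)).real ({m} ×ˢ {t : I | (t : ℝ) < c}) = ν.real {m} * c := by
    rw [measureReal_prod_prod,
      unitInterval.volume_real_lt hc (hcs.trans (d.scale_le_one _))]
  rw [← hS]
  refine d.toRandomExtension.le_operator _ (fun q => hp.nonneg _ _)
    ((measurableSet_singleton m).prod
      (measurableSet_lt measurable_subtype_coe measurable_const)) ?_
  rintro ⟨m', t⟩ ⟨hm, ht⟩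
  obtain rfl : m' = m := hm
  change _ ≤ pairExtension a b p (d.value z (m', t)) (d.value y (m', t))
  rw [d.value_of_lt z (lt_of_lt_of_le ht hcs)]
  refine hp.le_pairExtension_inr_left _ _ fun heq => ?_
  have hy : y ∉ X := by
    intro hy
    have := d.value_of_mem ⟨y, hy⟩ (m', t)
    simp only at this
    rw [this] at heq
    cases heq
  have hlt := d.lt_scale_of_value_eq_inr heq
  have := d.value_of_lt ⟨y, hy⟩ hlt
  simp only at this
  rw [this] at heq
  exact h t ht hy (Sum.inr.inj heq).symm

theorem le_extensionOperator_of_mem {p : X × X → ℝ} (hp : IsPseudometric p) (z : (Xᶜ : Set Y))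
    (x : X) : p (a, b) / 2 * (ν.real {0} * d.scale z) ≤ d.extensionOperator ν a b p (z, x) :=
  d.le_extensionOperator ν hp z x 0 (d.scale_pos _ z.2).le le_rfl fun _ _ hy => absurd x.2 hy

theorem isMetric_extensionOperator (hν : ∀ m, 0 < ν.real {m}) (hab : a ≠ b)
    (hsep : ∀ z z' : (Xᶜ : Set Y), z ≠ z' → ∃ m, ∃ η > 0, ∀ t : I, (t : ℝ) < η →
      (d.label m).select z t ≠ (d.label m).select z' t)
    {p : X × X → ℝ} (hp : IsMetric p) : IsMetric (d.extensionOperator ν a b p) := by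
  have hT : IsPseudometric (d.extensionOperator ν a b p) :=
    d.toRandomExtension.isPseudometric_operator _ hp.toIsPseudometric
  have hpos : 0 < p (a, b) := lt_of_le_of_ne (hp.nonneg _ _) fun h =>
    hab (hp.eq_of_eq_zero _ _ h.symm)
  have key : ∀ z : (Xᶜ : Set Y), ∀ y : Y, (z : Y) ≠ y →
      0 < d.extensionOperator ν a b p (z, y) := by
    intro z y hne
    have hs := d.scale_pos _ z.2
    by_cases hy : y ∈ X
    · refine lt_of_lt_of_le ?_ (d.le_extensionOperator_of_mem ν hp.toIsPseudometric z ⟨y, hy⟩)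
      have := hν 0
      positivity
    · obtain ⟨m, η, hη, h⟩ := hsep z ⟨y, hy⟩ fun e => hne (congrArg Subtype.val e)
      refine lt_of_lt_of_le ?_ (d.le_extensionOperator ν hp.toIsPseudometric z y m
        (c := min η (d.scale z)) (le_min hη.le hs.le) (min_le_right _ _)
        fun t ht _ => h t (ht.trans_le (min_le_left _ _)))
      have := hν m
      have : 0 < min η (d.scale z) := lt_min hη hs
      positivity
  refine ⟨hT, fun y y' h => ?_⟩
  by_contra hne
  by_cases hy : y ∈ X
  · by_cases hy' : y' ∈ X
    · have := d.toRandomExtension.isExtensionOperator (a := a) (b := b) (ν.prod volume) p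
        ⟨y, hy⟩ ⟨y', hy'⟩
      exact hne (congrArg Subtype.val (hp.eq_of_eq_zero _ _ (this.symm.trans h)))
    · rw [hT.symm] at h
      exact (key ⟨y', hy'⟩ y (Ne.symm hne)).ne' h
  · exact (key ⟨y, hy⟩ y' hne).ne' h

theorem isGoodExtension (hν : ∀ m, 0 < ν.real {m}) (hab : a ≠ b) (hX : IsClosed X)
    (hsep : ∀ z z' : (Xᶜ : Set Y), z ≠ z' → ∃ m, ∃ η > 0, ∀ t : I, (t : ℝ) < η →
      (d.label m).select z t ≠ (d.label m).select z' t) :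
    IsGoodExtension (d.extensionOperator ν a b) where
  extension := d.toRandomExtension.isExtensionOperator _
  regular := d.toRandomExtension.isRegularOperator _
  tricontinuous := (d.isContinuousFamily ν hX).isTricontinuous_operator hX
  bounded _ := d.toRandomExtension.isBoundedFun_operator _
  continuous _ := (d.isContinuousFamily ν hX).continuous_operator
  pseudometric _ := d.toRandomExtension.isPseudometric_operator _
  metric _ := d.isMetric_extensionOperator ν hν hab hsep

theorem preservesDominatingAdmissible (hν : ∀ m, 0 < ν.real {m}) (hab : a ≠ b)
    (hT : IsGoodExtension (d.extensionOperator ν a b))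
    (hsep : ∀ z₀ : (Xᶜ : Set Y), ∀ U ∈ 𝓝 (z₀ : Y), ∃ m, ∃ η > 0, ∀ z : (Xᶜ : Set Y), (z : Y) ∉ U →
      ∀ t : I, (t : ℝ) < η → (d.label m).select z₀ t ≠ (d.label m).select z t)
    (hmain : ∀ x₀ : X, ∀ U ∈ 𝓝 (x₀ : Y), ∃ V ∈ 𝓝 x₀, ∃ δ > 0, ∀ z : (Xᶜ : Set Y), d.scale z < δ →
      (∃ k, 0 < d.main.weight k z ∧ d.main.value k z ∈ V) → (z : Y) ∈ U) :
    PreservesDominatingAdmissible (d.extensionOperator ν a b) := by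
  have hdom : ∀ p, IsDominatingMetric p → IsDominatingMetric (d.extensionOperator ν a b p) := by
    intro p hp
    refine ⟨hT.metric p hp.toIsMetric, ?_⟩
    have hpm := hp.toIsPseudometric
    have hTp := hT.pseudometric p hpm
    have hpos : 0 < p (a, b) := lt_of_le_of_ne (hp.nonneg _ _) fun h =>
      hab (hp.eq_of_eq_zero _ _ h.symm)
    intro y₀ U hU hy₀U
    by_cases hy₀ : y₀ ∈ X
    · let x₀ : X := ⟨y₀, hy₀⟩
      obtain ⟨V, hV, δ, hδ, hVU⟩ := hmain x₀ U (hU.mem_nhds hy₀U)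
      have hV' : interior V ∩ (↑) ⁻¹' U ∈ 𝓝 x₀ := inter_mem (interior_mem_nhds.2 hV)
        (continuous_subtype_val.continuousAt.preimage_mem_nhds (hU.mem_nhds hy₀U))
      obtain ⟨ε, hε, hεV⟩ := hp.exists_ball x₀ _
        (isOpen_interior.inter (hU.preimage continuous_subtype_val)) (mem_of_mem_nhds hV')
      have h0 := hν 0
      -- The second bound forces s(y) < min δ (1/2). Then a point of X is selected at y whenever t ≥
      -- 1/2, that is, with probability at least 1/2; if all of these points were at distance at
      -- least ε from x₀, the T(p)-distance would be at least ε / 2.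
      refine ⟨min (ε / 2) (p (a, b) / 2 * (ν.real {0} * min δ (1 / 2))), by positivity,
        fun y hy => ?_⟩
      by_cases hyX : y ∈ X
      · have h1 : p (x₀, ⟨y, hyX⟩) < ε := by
          have := hT.extension p x₀ ⟨y, hyX⟩
          rw [← this]
          exact (hy.trans_le (min_le_left _ _)).trans (by linarith)
        exact (hεV _ h1).2
      · let z : (Xᶜ : Set Y) := ⟨y, hyX⟩
        have h1 := (d.le_extensionOperator_of_mem (a := a) (b := b) ν hpm z x₀).trans_lt
          ((hTp.symm _ _).trans_lt (hy.trans_le (min_le_right _ _)))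
        have h2 : d.scale z < min δ (1 / 2) := by
          by_contra hcon
          refine absurd h1 (not_lt.2 ?_)
          gcongr
          exact not_lt.1 hcon
        refine hVU z (h2.trans_le (min_le_left _ _)) ?_
        by_contra hcon
        push Not at hcon
        have hfar : ∀ t, ε ≤ p (x₀, d.main.select z t) := by
          intro t
          by_contra hlt
          exact hcon _ (d.main.weight_index_pos z t)
            (interior_subset (hεV _ (not_le.1 hlt)).1)
        have hS : (ν.prod (volume : Measure I)).real (univ ×ˢ {t : I | (t : ℝ) < 1 / 2}ᶜ) =
            1 / 2 := by
          rw [measureReal_univ_prod, measureReal_compl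
            (measurableSet_lt measurable_subtype_coe measurable_const),
            unitInterval.volume_real_lt (by norm_num) (by norm_num)]
          simp; norm_num
        have := d.toRandomExtension.le_operator (a := a) (b := b) (ν.prod (volume : Measure I))
          (p := p) (fun q => hp.nonneg _ _) (c := ε)
          (S := univ ×ˢ {t : I | (t : ℝ) < 1 / 2}ᶜ) (y := y₀) (y' := y)
          (MeasurableSet.univ.prod
            (measurableSet_lt measurable_subtype_coe measurable_const).compl) (by
          rintro ⟨m, t⟩ ⟨-, ht⟩
          change ε ≤ pairExtension a b p (d.value x₀ (m, t)) (d.value z (m, t))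
          rw [d.value_of_mem, d.value_of_not_lt z (fun h => ht
            (h.trans (h2.trans_le (min_le_right _ _))))]
          exact hfar t)
        rw [hS] at this
        have h3 := hy.trans_le (min_le_left _ _)
        change d.toRandomExtension.operator a b _ p (y₀, y) < _ at h3
        linarith
    · let z₀ : (Xᶜ : Set Y) := ⟨y₀, hy₀⟩
      obtain ⟨m, η, hη, hsep⟩ := hsep z₀ U (hU.mem_nhds hy₀U)
      have hs : 0 < d.scale z₀ := d.scale_pos _ hy₀
      have h0 := hν 0
      have hm := hν m
      refine ⟨min (p (a, b) / 2 * (ν.real {0} * d.scale z₀))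
        (p (a, b) / 2 * (ν.real {m} * min η (d.scale z₀))), by positivity, fun y hy => ?_⟩
      by_contra hyU
      by_cases hyX : y ∈ X
      · exact absurd (d.le_extensionOperator_of_mem (a := a) (b := b) ν hpm z₀ ⟨y, hyX⟩)
          (not_le.2 (hy.trans_le (min_le_left _ _)))
      · exact absurd (d.le_extensionOperator (a := a) (b := b) ν hpm z₀ y m
          (c := min η (d.scale z₀)) (by positivity) (min_le_right _ _)
          (fun t ht hy' => hsep ⟨y, hy'⟩ hyU t (ht.trans_le (min_le_left _ _))))
          (not_le.2 (hy.trans_le (min_le_right _ _)))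
  exact ⟨hdom, fun p hp => ⟨hdom p hp.toIsDominatingMetric, hT.continuous p hp.continuous⟩⟩

end ExtensionData

/-! ### Complete metrics -/

theorem IsPseudometric.tendsto_of_frequently {Z : Type*} {p : Z × Z → ℝ} (hp : IsPseudometric p)
    {u : ℕ → Z} (hu : ∀ ε > 0, ∃ N, ∀ m ≥ N, ∀ n ≥ N, p (u m, u n) < ε) {y : Z}
    (hy : ∀ ε > 0, ∃ᶠ n in atTop, p (u n, y) < ε) :
    Tendsto (fun n => p (u n, y)) atTop (𝓝 0) := by
  rw [Metric.tendsto_nhds]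
  intro ε hε
  obtain ⟨N, hN⟩ := hu (ε / 2) (half_pos hε)
  obtain ⟨m, hm, hmN⟩ := ((hy (ε / 2) (half_pos hε)).and_eventually (eventually_ge_atTop N)).exists
  filter_upwards [eventually_ge_atTop N] with n hn
  rw [Real.dist_eq, sub_zero, abs_of_nonneg (hp.nonneg _ _)]
  linarith [hp.triangle (u n) (u m) y, hN n hn m hmN]

namespace ExtensionData

theorem isCompleteAdmissibleMetric {Y L : Type*} [MetricSpace Y] [CompleteSpace Y] {X : Set Y}
    (d : ExtensionData X L) (ν : Measure ℕ) [IsProbabilityMeasure ν] {a b : X}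
    (hν : ∀ m, 0 < ν.real {m}) (hab : a ≠ b) (hX : IsCompact X)
    (hscale : ∀ ε > 0, ∃ δ > 0, ∀ y, d.scale y < δ → Metric.infDist y X < ε)
    (hlabel : ∀ ε > 0, ∃ m, ∀ (z z' : (Xᶜ : Set Y)) (t : I),
      (d.label m).select z t = (d.label m).select z' t → dist (z : Y) z' < ε)
    {p : X × X → ℝ} (hp : IsMetric p) (hTp : IsAdmissibleMetric (d.extensionOperator ν a b p)) :
    IsCompleteAdmissibleMetric (d.extensionOperator ν a b p) := by
  refine ⟨hTp, fun u hu => ?_⟩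
  have hpos : 0 < p (a, b) := lt_of_le_of_ne (hp.nonneg _ _) fun h =>
    hab (hp.eq_of_eq_zero _ _ h.symm)
  suffices h : ∃ y, MapClusterPt y atTop u by
    obtain ⟨y, hy⟩ := h
    refine ⟨y, hTp.toIsPseudometric.tendsto_of_frequently hu fun ε hε => ?_⟩
    have hc : Continuous fun w => d.extensionOperator ν a b p (w, y) :=
      hTp.continuous.comp (continuous_id.prodMk continuous_const)
    have : ∀ᶠ w in 𝓝 y, d.extensionOperator ν a b p (w, y) < ε :=
      (hc.tendsto y).eventually_lt_const (by rw [hTp.self]; exact hε)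
    exact mapClusterPt_iff_frequently.1 hy _ this
  -- Either the sequence stays away from X, and label separation makes it Cauchy for the metric of
  -- Y, or a subsequence approaches the compact set X and has a cluster point there.
  by_cases hs : ∃ δ > 0, ∀ᶠ n in atTop, δ ≤ d.scale (u n)
  · obtain ⟨δ, hδ, hs⟩ := hs
    have hcau : CauchySeq u := by
      rw [Metric.cauchySeq_iff]
      intro ε hε
      obtain ⟨m, hm⟩ := hlabel ε hε
      have hmν := hν m
      obtain ⟨N, hN⟩ := hu (p (a, b) / 2 * (ν.real {m} * δ)) (by positivity)
      obtain ⟨N', hN'⟩ := eventually_atTop.1 hs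
      have hnX : ∀ n ≥ N', u n ∉ X := by
        intro n hn hX
        have := hN' n hn
        rw [d.scale_eq_zero _ hX] at this
        linarith
      refine ⟨max N N', fun i hi j hj => ?_⟩
      have hi' := hnX i (le_of_max_le_right hi)
      have hj' := hnX j (le_of_max_le_right hj)
      by_contra hcon
      refine absurd (hN i (le_of_max_le_left hi) j (le_of_max_le_left hj)) (not_lt.2 ?_)
      exact d.le_extensionOperator ν hp.toIsPseudometric ⟨u i, hi'⟩ (u j) m hδ.le
        (hN' i (le_of_max_le_right hi)) fun t _ hy heq => hcon (hm _ _ t heq)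
    obtain ⟨y, hy⟩ := cauchySeq_tendsto_of_complete hcau
    exact ⟨y, hy.mapClusterPt⟩
  · push Not at hs
    have hfreq : ∀ k : ℕ, ∃ n ≥ k, Metric.infDist (u n) X < 1 / ((k : ℝ) + 1) := by
      intro k
      obtain ⟨δ, hδ, h⟩ := hscale (1 / ((k : ℝ) + 1)) (by positivity)
      obtain ⟨n, hn, hnk⟩ := ((hs δ hδ).and_eventually (eventually_ge_atTop k)).exists
      exact ⟨n, hnk, h _ hn⟩
    choose n hnk hn using hfreq
    have hne : X.Nonempty := ⟨a, a.2⟩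
    choose x hxX hx using fun k => hX.exists_infDist_eq_dist hne (u (n k))
    obtain ⟨x₀, -, φ, hφ, hlim⟩ := hX.tendsto_subseq hxX
    have hdist : Tendsto (fun k => dist (u (n k)) (x k)) atTop (𝓝 0) :=
      squeeze_zero (fun _ => dist_nonneg) (fun k => by rw [← hx]; exact (hn k).le)
        tendsto_one_div_add_atTop_nhds_zero_nat
    have hlim' : Tendsto (fun k => u (n (φ k))) atTop (𝓝 x₀) := by
      refine (tendsto_iff_of_dist ?_).2 hlim
      exact hdist.comp hφ.tendsto_atTop
    have hn_top : Tendsto (fun k => n (φ k)) atTop atTop :=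
      (tendsto_atTop_mono hnk tendsto_id).comp hφ.tendsto_atTop
    exact ⟨x₀, hlim'.mapClusterPt.of_comp hn_top⟩

end ExtensionData

/-! ### Totally bounded pseudometrics -/

theorem lt_of_floor_mul_eq {M t t' w : ℝ} (hM : 0 < M) (ht : 0 ≤ t)
    (h : ⌊M * t⌋₊ = ⌊M * t'⌋₊) (hw : 0 < w → ⌊M * w⌋₊ ≠ ⌊M * t⌋₊) (htw : t < w) : t' < w := by
  have hw0 : 0 < w := ht.trans_lt htw
  have hle : ⌊M * t⌋₊ ≤ ⌊M * w⌋₊ := Nat.floor_le_floor (by gcongr)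
  have hlt : ⌊M * t'⌋₊ + 1 ≤ ⌊M * w⌋₊ := by
    have := hw hw0
    omega
  have h1 : M * t' < ⌊M * t'⌋₊ + 1 := Nat.lt_floor_add_one _
  have h2 : (⌊M * w⌋₊ : ℝ) ≤ M * w := Nat.floor_le (by positivity)
  have h3 : ((⌊M * t'⌋₊ + 1 : ℕ) : ℝ) ≤ ⌊M * w⌋₊ := by exact_mod_cast hlt
  push_cast at h3
  exact lt_of_mul_lt_mul_left (h1.trans_le (h3.trans h2)) hM.le

/-- Two parameters in one cell of length 1/M lie on the same side of any threshold outside that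
cell. A nonpositive threshold separates no parameters, which matters because the natural floor of a
negative number is 0. -/
theorem lt_iff_of_floor_mul_eq {M t t' w : ℝ} (hM : 0 < M) (ht : 0 ≤ t) (ht' : 0 ≤ t')
    (h : ⌊M * t⌋₊ = ⌊M * t'⌋₊) (hw : 0 < w → ⌊M * w⌋₊ ≠ ⌊M * t⌋₊) : t < w ↔ t' < w :=
  ⟨lt_of_floor_mul_eq hM ht h hw, lt_of_floor_mul_eq hM ht' h.symm fun hw0 => h ▸ hw hw0⟩

theorem unitInterval.volume_real_floor_le {M : ℝ} (hM : 0 < M) (i : ℕ) :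
    (volume : Measure I).real {t | ⌊M * (t : ℝ)⌋₊ = i} ≤ 1 / M := by
  rw [measureReal_def]
  refine ENNReal.toReal_le_of_le_ofReal (by positivity) ?_
  have : (1 / M : ℝ) = ((i : ℝ) + 1) / M - i / M := by ring
  rw [unitInterval.volume_apply, this, ← Real.volume_Icc]
  refine measure_mono ?_
  rintro _ ⟨t, rfl, rfl⟩
  rw [mem_Icc, div_le_iff₀ hM, le_div_iff₀ hM, mul_comm _ M]
  exact ⟨Nat.floor_le (mul_nonneg hM.le t.2.1), (Nat.lt_floor_add_one _).le⟩

theorem unitInterval.volume_real_floor_mem_le {M : ℝ} (hM : 0 < M) (B : Finset ℕ) :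
    (volume : Measure I).real {t | ⌊M * (t : ℝ)⌋₊ ∈ B} ≤ B.card / M := by
  have : {t : I | ⌊M * (t : ℝ)⌋₊ ∈ B} = ⋃ i ∈ B, {t : I | ⌊M * (t : ℝ)⌋₊ = i} := by
    ext t; simp
  rw [this]
  refine (measureReal_biUnion_finset_le _ _).trans
    ((Finset.sum_le_card_nsmul _ _ _ fun i _ => unitInterval.volume_real_floor_le hM i).trans ?_)
  rw [nsmul_eq_mul, mul_one_div]

theorem measurableSet_floor_mem (M : ℝ) (B : Finset ℕ) :
    MeasurableSet {t : I | ⌊M * (t : ℝ)⌋₊ ∈ B} :=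
  (Nat.measurable_floor.comp (measurable_subtype_coe.const_mul M)) (MeasurableSet.of_discrete
    (s := (B : Set ℕ)))

theorem IsTotallyBoundedPseudometric.exists_bound {A : Type*} {p : A × A → ℝ}
    (hp : IsTotallyBoundedPseudometric p) : ∃ D, ∀ x y, p (x, y) ≤ D := by
  obtain ⟨F, hF⟩ := hp.exists_net 1 one_pos
  obtain ⟨D, hD⟩ := ((F ×ˢ F).image p).bddAbove
  refine ⟨1 + D + 1, fun x y => ?_⟩
  obtain ⟨e, he, hxe⟩ := hF x
  obtain ⟨e', he', hye⟩ := hF y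
  have h1 : p (e, e') ≤ D := hD (by
    simp only [Finset.coe_image, Finset.coe_product]
    exact ⟨(e, e'), ⟨he, he'⟩, rfl⟩)
  linarith [hp.triangle x e y, hp.triangle e e' y, hp.symm y e']

theorem exists_finset_net_of_code {A C : Type*} [Finite C] {S : Set A} (code : S → C)
    {q : A × A → ℝ} {ε : ℝ} (h : ∀ x y : S, code x = code y → q (x, y) < ε) :
    ∃ F : Finset A, ∀ x ∈ S, ∃ e ∈ F, q (x, e) < ε := by
  classical
  have hfin : (range fun c : range code => ((Classical.choose c.2 : S) : A)).Finite :=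
    finite_range _
  refine ⟨hfin.toFinset, fun x hx => ?_⟩
  let c : range code := ⟨code ⟨x, hx⟩, mem_range_self _⟩
  refine ⟨(Classical.choose c.2 : S), by rw [Finite.mem_toFinset]; exact mem_range_self c, ?_⟩
  exact h ⟨x, hx⟩ (Classical.choose c.2) (Classical.choose_spec c.2).symm

namespace SelectionSystem

variable {Z A : Type*} [TopologicalSpace Z] (τ : SelectionSystem Z A)

theorem select_eq_of_floor_eq {M : ℝ} (hM : 0 < M) {z : Z} {t t' : I}
    (h : ⌊M * (t : ℝ)⌋₊ = ⌊M * (t' : ℝ)⌋₊)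
    (hw : ∀ k, 0 < τ.weight k z → ⌊M * τ.weight k z⌋₊ ≠ ⌊M * (t : ℝ)⌋₊) :
    τ.select z t = τ.select z t' := by
  have : τ.index z t = τ.index z t' := τ.index_congr fun k _ =>
    lt_iff_of_floor_mul_eq hM t.2.1 t'.2.1 h (hw k)
  rw [select, select, this]

theorem exists_finset_floor {N : ℕ} (hN : ∀ z, {k | 0 < τ.weight k z}.encard ≤ N) (M : ℝ)
    (z : Z) : ∃ B : Finset ℕ, B.card ≤ N ∧ ∀ k, 0 < τ.weight k z → ⌊M * τ.weight k z⌋₊ ∈ B := by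
  classical
  have hfin : {k | 0 < τ.weight k z}.Finite := finite_of_encard_le_coe (hN z)
  refine ⟨hfin.toFinset.image fun k => ⌊M * τ.weight k z⌋₊, ?_, fun k hk => ?_⟩
  · refine Finset.card_image_le.trans ?_
    have := hN z
    rw [hfin.encard_eq_coe_toFinset_card] at this
    exact_mod_cast this
  · exact Finset.mem_image_of_mem _ (hfin.mem_toFinset.2 hk)

end SelectionSystem

namespace ExtensionData

variable {Y L : Type*} [TopologicalSpace Y] {X : Set Y} (d : ExtensionData X L)
  (ν : Measure ℕ) [IsProbabilityMeasure ν] {a b : X}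

/-- The bad cells contain a threshold at which the value may jump: one for the scale, at most N for
the main system, and at most N for each of the first J label systems. -/
theorem exists_finset_bad {N : ℕ} (hmain : ∀ z, {k | 0 < d.main.weight k z}.encard ≤ N)
    (hlabel : ∀ m z, {k | 0 < (d.label m).weight k z}.encard ≤ N) {M : ℝ} (hM : 0 < M) (J : ℕ)
    (z : (Xᶜ : Set Y)) : ∃ B : Finset ℕ, B.card ≤ 1 + N + J * N ∧ ∀ t t' : I,
      ⌊M * (t : ℝ)⌋₊ = ⌊M * (t' : ℝ)⌋₊ → ⌊M * (t : ℝ)⌋₊ ∉ B → ∀ m < J,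
      d.value z (m, t) = d.value z (m, t') := by
  classical
  obtain ⟨B, hBN, hB⟩ := d.main.exists_finset_floor hmain M z
  choose C hCN hC using fun m => (d.label m).exists_finset_floor (hlabel m) M z
  refine ⟨{⌊M * d.scale z⌋₊} ∪ B ∪ (Finset.range J).biUnion C, ?_, ?_⟩
  · have h1 := Finset.card_union_le ({⌊M * d.scale z⌋₊} ∪ B) ((Finset.range J).biUnion C)
    have h2 := Finset.card_union_le {⌊M * d.scale z⌋₊} B
    have h3 := Finset.card_biUnion_le_card_mul (Finset.range J) C N fun m _ => hCN m
    simp only [Finset.card_range, Finset.card_singleton] at h2 h3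
    omega
  · intro t t' htt hnot m hm
    simp only [Finset.mem_union, Finset.mem_singleton, Finset.mem_biUnion, Finset.mem_range,
      not_or, not_exists, not_and] at hnot
    obtain ⟨⟨h1, h2⟩, h3⟩ := hnot
    have hs : (t : ℝ) < d.scale z ↔ (t' : ℝ) < d.scale z :=
      lt_iff_of_floor_mul_eq hM t.2.1 t'.2.1 htt fun _ => Ne.symm h1
    by_cases hts : (t : ℝ) < d.scale z
    · rw [d.value_of_lt z hts, d.value_of_lt z (ω := (m, t')) (hs.1 hts)]
      refine congrArg _ ((d.label m).select_eq_of_floor_eq hM htt fun k hk heq => h3 m hm ?_)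
      rw [← heq]
      exact hC m k hk
    · rw [d.value_of_not_lt z hts, d.value_of_not_lt z (ω := (m, t')) fun h => hts (hs.2 h)]
      refine congrArg _ (d.main.select_eq_of_floor_eq hM htt fun k hk heq => h2 ?_)
      rw [← heq]
      exact hB k hk

theorem isTotallyBoundedPseudometric {N : ℕ}
    (hmain : ∀ z, {k | 0 < d.main.weight k z}.encard ≤ N)
    (hlabel : ∀ m z, {k | 0 < (d.label m).weight k z}.encard ≤ N)
    (hfin : ∀ m, {w | ∃ k z, (d.label m).value k z = w}.Finite)
    {p : X × X → ℝ} (hp : IsTotallyBoundedPseudometric p) :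
    IsTotallyBoundedPseudometric (d.extensionOperator ν a b p) := by
  classical
  have hpm := hp.toIsPseudometric
  have hTp : IsPseudometric (d.extensionOperator ν a b p) :=
    d.toRandomExtension.isPseudometric_operator _ hpm
  refine ⟨hTp, fun ε hε => ?_⟩
  obtain ⟨D, hD⟩ := hp.exists_bound
  have hD0 : 0 ≤ D := (hp.nonneg a a).trans (hD a a)
  obtain ⟨A, hA⟩ := hp.exists_net (ε / 8) (by positivity)
  choose near hnearA hnear using hA
  obtain ⟨J, hJ⟩ := exists_measureReal_Ici_lt ν (ε := ε / (8 * (D + 1))) (by positivity)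
  -- Two points have at most 2 (1 + N + J N) bad cells, of measure at most 1/M each; M makes their
  -- total at most ε / (8 (D + 1)), the same as the discarded tail.
  obtain ⟨M, hM⟩ := exists_nat_gt (2 * (1 + N + J * N : ℕ) * 8 * (D + 1) / ε)
  have hM0 : (0 : ℝ) < M := lt_of_le_of_lt (by positivity) hM
  choose B hBcard hB using fun z => d.exists_finset_bad hmain hlabel hM0 J z
  have hnode : ∃ node : ℕ → I, ∀ t : I,
      ⌊(M : ℝ) * (t : ℝ)⌋₊ = ⌊(M : ℝ) * (node ⌊(M : ℝ) * (t : ℝ)⌋₊ : ℝ)⌋₊ := by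
    refine ⟨fun i => if h : ∃ t : I, ⌊(M : ℝ) * (t : ℝ)⌋₊ = i then h.choose else 0, fun t => ?_⟩
    have h : ∃ t' : I, ⌊(M : ℝ) * (t' : ℝ)⌋₊ = ⌊(M : ℝ) * (t : ℝ)⌋₊ := ⟨t, rfl⟩
    simp only [h, dif_pos]
    exact h.choose_spec.symm
  obtain ⟨node, hnode⟩ := hnode
  -- There are M + 1 cells because t = 1 has one of its own.
  have hcell : ∀ t : I, ⌊(M : ℝ) * (t : ℝ)⌋₊ < M + 1 := fun t => by
    rw [Nat.lt_succ_iff]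
    refine Nat.floor_le_of_le ?_
    have := mul_le_mul_of_nonneg_left t.2.2 hM0.le
    simpa using this
  let cls : X ⊕ L → X ⊕ L := Sum.map near id
  let F : Fin J → Set (X ⊕ L) := fun m => Sum.inl '' (A : Set X) ∪
    Sum.inr '' {w | ∃ k z, (d.label m).value k z = w}
  have hF : ∀ m, (F m).Finite := fun m =>
    (A.finite_toSet.image _).union ((hfin m).image _)
  have : ∀ m, Finite (F m) := fun m => (hF m).to_subtype
  have hclsF : ∀ (z : (Xᶜ : Set Y)) (t : I) (m : Fin J), cls (d.value z (m, t)) ∈ F m := by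
    intro z t m
    by_cases ht : (t : ℝ) < d.scale z
    · rw [d.value_of_lt z ht]
      exact Or.inr ⟨_, ⟨_, _, rfl⟩, rfl⟩
    · rw [d.value_of_not_lt z ht]
      exact Or.inl ⟨_, hnearA _, rfl⟩
  -- The code records, for each cell and each m < J, the label or the net point near the selected
  -- point. It has finitely many values, and equal codes make the integrand at most ε / 4 outside
  -- the bad event.
  let code : (Xᶜ : Set Y) → Fin (M + 1) → (m : Fin J) → F m := fun z i m =>
    ⟨cls (d.value z (m, node i)), hclsF z _ m⟩
  have hcls : ∀ v w : X ⊕ L, cls v = cls w → pairExtension a b p v w ≤ ε / 4 := by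
    intro v w hvw
    rcases v with x | v <;> rcases w with y | w <;> simp only [cls, Sum.map_inl, Sum.map_inr,
      Sum.inl.injEq, Sum.inr.injEq, id, reduceCtorEq] at hvw
    · simp only [pairExtension]
      have h1 := hp.triangle x (near x) y
      have h2 := hnear x
      have h3 := hnear y
      rw [← hvw, hp.symm] at h3
      linarith
    · subst hvw
      have := (hpm.pairExtension (L := L) (a := a) (b := b)).self (.inr v)
      simp only at this
      rw [this]; positivity
  have hcode : ∀ z z' : (Xᶜ : Set Y), code z = code z' →
      d.extensionOperator ν a b p (z, z') < ε := by
    intro z z' hzz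
    let S : Set (ℕ × I) := Ici J ×ˢ univ ∪ univ ×ˢ {t : I | ⌊(M : ℝ) * (t : ℝ)⌋₊ ∈ B z ∪ B z'}
    have hSm : MeasurableSet S := (measurableSet_Ici.prod MeasurableSet.univ).union
      (MeasurableSet.univ.prod (measurableSet_floor_mem _ _))
    have hint := RandomExtension.abs_integral_le_of_le_off (ν.prod (volume : Measure I))
      (g := fun ω => pairExtension a b p (d.value z ω) (d.value z' ω)) hSm (c := ε / 4) (M := D)
      (by positivity) (fun ω => abs_pairExtension_le (D := univ) (E := univ) trivial trivial
        trivial trivial (fun x _ y _ => by rw [abs_of_nonneg (hp.nonneg x y)]; exact hD x y)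
        (fun _ _ => trivial) (fun _ _ => trivial)) (by
      rintro ⟨m, t⟩ hmt
      simp only [S, mem_union, mem_prod, mem_Ici, mem_univ, and_true, true_and, not_or, not_le,
        mem_ofPred_eq, Finset.mem_union] at hmt
      obtain ⟨hm, hz, hz'⟩ := hmt
      rw [abs_of_nonneg (pairExtension_nonneg (fun q => hp.nonneg _ _) _ _)]
      rw [hB z t _ (hnode t) hz m hm, hB z' t _ (hnode t) hz' m hm]
      have := congrArg Subtype.val (congrFun (congrFun hzz ⟨_, hcell t⟩) ⟨m, hm⟩)
      exact hcls _ _ this)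
    have hS : (ν.prod (volume : Measure I)).real S ≤
        ε / (8 * (D + 1)) + (2 * (1 + N + J * N : ℕ)) / M := by
      refine (measureReal_union_le _ _).trans (add_le_add ?_ ?_)
      · rw [measureReal_prod_prod]
        simpa using hJ.le
      · rw [measureReal_univ_prod]
        refine (unitInterval.volume_real_floor_mem_le hM0 _).trans ?_
        gcongr
        have h1 := Finset.card_union_le (B z) (B z')
        have h2 := hBcard z
        have h3 := hBcard z'
        exact_mod_cast (show (B z ∪ B z').card ≤ 2 * (1 + N + J * N) by omega)
    have hM2 : (2 * (1 + N + J * N : ℕ)) / (M : ℝ) ≤ ε / (8 * (D + 1)) := by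
      rw [div_lt_iff₀ hε] at hM
      rw [div_le_div_iff₀ hM0 (by positivity)]
      nlinarith [hM]
    have h4 : D * (ν.prod (volume : Measure I)).real S ≤ ε / 4 := by
      calc D * (ν.prod (volume : Measure I)).real S
          ≤ (D + 1) * (ε / (8 * (D + 1)) + ε / (8 * (D + 1))) := by
            gcongr
            · linarith
            · exact hS.trans (by linarith)
        _ = ε / 4 := by field_simp; norm_num
    have h5 := (le_abs_self _).trans hint
    change d.extensionOperator ν a b p (z, z') ≤ _ at h5
    linarith
  obtain ⟨F₁, hF₁⟩ := exists_finset_net_of_code code hcode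
  obtain ⟨F₂, hF₂⟩ := hp.exists_net ε hε
  refine ⟨F₁ ∪ F₂.image (↑), fun y => ?_⟩
  by_cases hy : y ∈ X
  · obtain ⟨e, he, hlt⟩ := hF₂ ⟨y, hy⟩
    refine ⟨e, Finset.mem_union_right _ (Finset.mem_image_of_mem _ he), ?_⟩
    have := d.toRandomExtension.isExtensionOperator (a := a) (b := b) (ν.prod volume) p ⟨y, hy⟩ e
    exact this.trans_lt hlt
  · obtain ⟨e, he, hlt⟩ := hF₁ y hy
    exact ⟨e, Finset.mem_union_left _ he, hlt⟩

end ExtensionData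

/-! ### Normality and open covers of stratifiable spaces -/

/-- A stratification of a topological space which increases with the index. -/
structure IsStratification {Y : Type*} [TopologicalSpace Y] (S : Set Y → ℕ → Set Y) : Prop where
  isOpen : ∀ U, IsOpen U → ∀ n, IsOpen (S U n)
  closure_subset : ∀ U, IsOpen U → ∀ n, closure (S U n) ⊆ U
  exists_mem : ∀ U, IsOpen U → ∀ y ∈ U, ∃ n, y ∈ S U n
  mono : ∀ U V, IsOpen U → IsOpen V → U ⊆ V → ∀ n, S U n ⊆ S V n
  mono_nat : ∀ U m n, m ≤ n → S U m ⊆ S U n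

theorem exists_isStratification (Y : Type*) [TopologicalSpace Y] [StratifiableSpace Y] :
    ∃ S : Set Y → ℕ → Set Y, IsStratification S := by
  obtain ⟨S, h1, h2, h3, h4⟩ := StratifiableSpace.exists_stratification (Y := Y)
  refine ⟨fun U n => ⋃ k ∈ Finset.range (n + 1), S U k, ?_, ?_, ?_, ?_, ?_⟩
  · exact fun U hU n => isOpen_biUnion fun k _ => h1 U hU k
  · intro U hU n
    rw [Finset.closure_biUnion]
    exact iUnion₂_subset fun k _ => h2 U hU k
  · intro U hU y hy
    rw [← h3 U hU] at hy
    obtain ⟨n, hn⟩ := mem_iUnion.1 hy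
    exact ⟨n, mem_biUnion (Finset.mem_coe.2 (Finset.self_mem_range_succ n)) hn⟩
  · exact fun U V hU hV hUV n => iUnion₂_mono fun k _ => h4 U V hU hV hUV k
  · intro U m n hmn
    refine biUnion_subset_biUnion_left fun k hk => ?_
    exact Finset.mem_coe.2 (Finset.mem_range.2 (by
      have := Finset.mem_range.1 (Finset.mem_coe.1 hk)
      omega))

namespace IsStratification

variable {Y : Type*} [TopologicalSpace Y] {S : Set Y → ℕ → Set Y}

theorem subset (hS : IsStratification S) {U : Set Y} (hU : IsOpen U) (n : ℕ) : S U n ⊆ U :=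
  subset_closure.trans (hS.closure_subset U hU n)

theorem mono₂ (hS : IsStratification S) {U V : Set Y} (hU : IsOpen U) (hV : IsOpen V)
    (h : U ⊆ V) {m n : ℕ} (hmn : m ≤ n) :
    S U m ⊆ S V n :=
  (hS.mono U V hU hV h m).trans (hS.mono_nat V m n hmn)

end IsStratification

theorem IsOpen.stratifiableSpace {Y : Type*} [TopologicalSpace Y] [StratifiableSpace Y]
    {W : Set Y} (hW : IsOpen W) : StratifiableSpace W := by
  obtain ⟨S, hS⟩ := exists_isStratification Y
  have hopen : ∀ U : Set W, IsOpen U → IsOpen ((↑) '' U : Set Y) := fun U hU =>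
    hW.isOpenMap_subtype_val U hU
  refine ⟨⟨fun U n => (↑) ⁻¹' S ((↑) '' U) n, ?_, ?_, ?_, ?_⟩⟩
  · exact fun U hU n => (hS.isOpen _ (hopen U hU) n).preimage continuous_subtype_val
  · intro U hU n w hw
    have h1 := continuous_subtype_val.closure_preimage_subset _ hw
    obtain ⟨w', hw', heq⟩ := hS.closure_subset _ (hopen U hU) n h1
    rwa [← Subtype.val_injective heq]
  · intro U hU
    ext w
    rw [mem_iUnion]
    constructor
    · rintro ⟨n, hn⟩
      obtain ⟨w', hw', heq⟩ := hS.subset (hopen U hU) n hn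
      rwa [← Subtype.val_injective heq]
    · exact fun hw => hS.exists_mem _ (hopen U hU) w ⟨w, hw, rfl⟩
  · exact fun U V hU hV hUV n => preimage_mono
      (hS.mono _ _ (hopen U hU) (hopen V hV) (image_mono hUV) n)

section Stratifiable

variable {Z : Type*} [TopologicalSpace Z] [StratifiableSpace Z]

/-- This is collectionwise normality. If k ≤ l, the k-th stratum of the complement of the union of
all E j with j ≠ i lies in the l-th stratum of the complement of each such E j, which the l-th piece
of the expansion of E j avoids. -/
theorem exists_disjoint_open_expansion {ι : Type*} (E : ι → Set Z) (hE : ∀ i, IsClosed (E i))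
    (hlf : ∀ i, IsClosed (⋃ j : {j // j ≠ i}, E j.1))
    (hdisj : ∀ i j, i ≠ j → Disjoint (E i) (E j)) :
    ∃ O : ι → Set Z, (∀ i, IsOpen (O i)) ∧ (∀ i, E i ⊆ O i) ∧
      ∀ i j, i ≠ j → Disjoint (O i) (O j) := by
  obtain ⟨S, hS⟩ := exists_isStratification Z
  let H : ι → Set Z := fun i => ⋃ j : {j // j ≠ i}, E j.1
  have hHo : ∀ i, IsOpen (H i)ᶜ := fun i => (hlf i).isOpen_compl
  have hEo : ∀ i, IsOpen (E i)ᶜ := fun i => (hE i).isOpen_compl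
  refine ⟨fun i => ⋃ k, S (H i)ᶜ k \ closure (S (E i)ᶜ k), ?_, ?_, ?_⟩
  · exact fun i => isOpen_iUnion fun k =>
      (hS.isOpen _ (hHo i) k).sdiff isClosed_closure
  · intro i z hz
    have hzH : z ∈ (H i)ᶜ := by
      rw [mem_compl_iff, mem_iUnion, not_exists]
      exact fun j hj => disjoint_left.1 (hdisj i j (Ne.symm j.2)) hz hj
    obtain ⟨k, hk⟩ := hS.exists_mem _ (hHo i) z hzH
    exact mem_iUnion.2 ⟨k, hk, fun h => hS.closure_subset _ (hEo i) k h hz⟩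
  · have key : ∀ i j, i ≠ j → ∀ k k', k ≤ k' → ∀ z, z ∈ S (H i)ᶜ k →
        z ∉ closure (S (E j)ᶜ k') → False := by
      intro i j hij k k' hk z hz hz'
      refine hz' (subset_closure (hS.mono₂ (hHo i) (hEo j) (compl_subset_compl.2 ?_) hk hz))
      exact subset_iUnion (fun j : {j // j ≠ i} => E j.1) ⟨j, Ne.symm hij⟩
    intro i j hij
    rw [disjoint_left]
    intro z hzi hzj
    obtain ⟨k, hk, hk'⟩ := mem_iUnion.1 hzi
    obtain ⟨l, hl, hl'⟩ := mem_iUnion.1 hzj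
    rcases le_total k l with h | h
    · exact key i j hij k l h z hk hl'
    · exact key j i (Ne.symm hij) l k h z hl hk'

theorem StratifiableSpace.normalSpace : NormalSpace Z := by
  refine ⟨fun s t hs ht hst => ?_⟩
  have hcl : ∀ i : Bool, IsClosed (cond i s t) := by rintro (_ | _) <;> assumption
  obtain ⟨O, hO, hEO, hd⟩ := exists_disjoint_open_expansion (fun i : Bool => cond i s t) hcl
    (fun i => isClosed_iUnion_of_finite fun j => hcl j) (by
      rintro (_ | _) (_ | _) h
      · exact absurd rfl h
      · exact hst.symm
      · exact hst
      · exact absurd rfl h)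
  exact ⟨O true, O false, hO _, hO _, hEO true, hEO false, hd _ _ (by simp)⟩

/-- Perfect normality: a geometric series of Urysohn functions, one for each stratum. -/
theorem IsOpen.exists_continuous_pos_iff {V : Set Z} (hV : IsOpen V) :
    ∃ g : Z → ℝ, Continuous g ∧ (∀ z, 0 ≤ g z) ∧ (∀ z, g z ≤ 1) ∧ ∀ z, 0 < g z ↔ z ∈ V := by
  have := StratifiableSpace.normalSpace (Z := Z)
  obtain ⟨S, hS⟩ := exists_isStratification Z
  have hf : ∀ n, ∃ f : C(Z, ℝ), EqOn f 0 Vᶜ ∧ EqOn f 1 (closure (S V n)) ∧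
      ∀ z, f z ∈ Icc (0 : ℝ) 1 := fun n =>
    exists_continuous_zero_one_of_isClosed hV.isClosed_compl isClosed_closure
      (disjoint_compl_left_iff_subset.2 (hS.closure_subset V hV n))
  choose f hf0 hf1 hf using hf
  have hnn : ∀ n z, 0 ≤ (1 / 2 : ℝ) ^ n * f n z := fun n z =>
    mul_nonneg (by positivity) (hf n z).1
  have hle : ∀ n z, (1 / 2 : ℝ) ^ n * f n z ≤ (1 / 2) ^ n := fun n z =>
    mul_le_of_le_one_right (by positivity) (hf n z).2
  have hsum : ∀ z, Summable fun n => (1 / 2 : ℝ) ^ n * f n z := fun z =>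
    summable_geometric_two.of_nonneg_of_le (fun n => hnn n z) (fun n => hle n z)
  refine ⟨fun z => min (∑' n, (1 / 2 : ℝ) ^ n * f n z) 1, ?_, ?_, fun z => min_le_right _ _, ?_⟩
  · refine Continuous.min ?_ continuous_const
    refine continuous_tsum (fun n => continuous_const.mul (f n).continuous)
      summable_geometric_two fun n z => ?_
    rw [Real.norm_of_nonneg (hnn n z)]
    exact hle n z
  · exact fun z => le_min (tsum_nonneg fun n => hnn n z) zero_le_one
  · intro z
    constructor
    · intro h
      by_contra hz
      have : ∀ n, (1 / 2 : ℝ) ^ n * f n z = 0 := fun n => by rw [hf0 n hz]; simp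
      have h := h.trans_le (min_le_left _ _)
      rw [tsum_congr this, tsum_zero] at h
      exact lt_irrefl _ h
    · intro hz
      obtain ⟨n, hn⟩ := hS.exists_mem V hV z hz
      refine lt_min ((hsum z).tsum_pos (fun n => hnn n z) n ?_) one_pos
      rw [hf1 n (subset_closure hn)]
      simp

/-- Every open cover of a stratifiable space is refined by the cozero sets of a sequence of
functions, in such a way that the refinement is locally constant on each of these sets. -/
theorem exists_functions_of_open_cover (O : Z → Set Z) (hO : ∀ x, IsOpen (O x))
    (hmem : ∀ x, x ∈ O x) : ∃ (g : ℕ → Z → ℝ) (v : ℕ → Z → Z), (∀ n, Continuous (g n)) ∧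
      (∀ n z, 0 ≤ g n z) ∧ (∀ n z, g n z ≤ 1) ∧ (∀ z, ∃ n, 0 < g n z) ∧
      (∀ n z₀, 0 < g n z₀ → ∀ᶠ z in 𝓝 z₀, v n z = v n z₀) ∧
      ∀ n z, 0 < g n z → z ∈ O (v n z) := by
  classical
  have := StratifiableSpace.normalSpace (Z := Z)
  obtain ⟨S, hS⟩ := exists_isStratification Z
  obtain ⟨_, _⟩ := exists_wellFoundedLT Z
  let V : Z → Set Z := fun x => ⋃ y ∈ Iio x, O y
  have hV : ∀ x, IsOpen (V x) := fun x => isOpen_biUnion fun y _ => hO y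
  -- Along a well-order of Z, each stratum of a member is stripped of all earlier members. For fixed
  -- n these closed sets form a discrete family, and together they cover Z.
  let E : ℕ → Z → Set Z := fun n x => closure (S (O x) n) \ V x
  have hEO : ∀ n x, E n x ⊆ O x := fun n x =>
    sdiff_subset.trans (hS.closure_subset _ (hO x) n)
  have hEcl : ∀ n x, IsClosed (E n x) := fun n x => isClosed_closure.sdiff (hV x)
  have hfirst : ∀ z, ∃ x, z ∈ O x ∧ z ∉ V x := by
    intro z
    obtain ⟨x, hx, hmin⟩ := WellFounded.has_min (wellFounded_lt (α := Z)) {x | z ∈ O x} ⟨z, hmem z⟩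
    refine ⟨x, hx, fun h => ?_⟩
    obtain ⟨y, hy, hzy⟩ := mem_iUnion₂.1 h
    exact hmin y hzy hy
  have hdisj : ∀ n x y, x ≠ y → Disjoint (E n x) (E n y) := by
    have key : ∀ n x y, x < y → Disjoint (E n x) (E n y) := fun n x y hxy =>
      disjoint_left.2 fun z hzx hzy => hzy.2 (mem_biUnion (mem_Iio.2 hxy) (hEO n x hzx))
    intro n x y hxy
    rcases lt_or_gt_of_ne hxy with h | h
    · exact key n x y h
    · exact (key n y x h).symm
  have hlf : ∀ n, LocallyFinite (E n) := by
    intro n z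
    obtain ⟨x, hx, hxV⟩ := hfirst z
    -- With x the first index whose member contains z, this neighborhood misses E n y for y < x by
    -- monotonicity of the strata, and for y > x because O x has been removed there.
    refine ⟨O x ∩ (closure (S (V x) n))ᶜ, inter_mem ((hO x).mem_nhds hx)
      (isClosed_closure.isOpen_compl.mem_nhds fun h => hxV (hS.closure_subset _ (hV x) n h)),
      (finite_singleton x).subset ?_⟩
    rintro y ⟨w, hwE, hwO, hwV⟩
    rcases lt_trichotomy y x with h | h | h
    · refine absurd (closure_mono (hS.mono _ _ (hO y) (hV x) ?_ n) hwE.1) hwV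
      exact subset_biUnion_of_mem (u := fun y => O y) (mem_Iio.2 h)
    · exact h
    · exact absurd (mem_biUnion (mem_Iio.2 h) hwO) hwE.2
  have hexp := fun n => exists_disjoint_open_expansion (E n) (hEcl n)
    (fun i => ((hlf n).comp_injective Subtype.val_injective).isClosed_iUnion fun j => hEcl n j)
    (hdisj n)
  choose D hDo hED hDd using hexp
  let G : ℕ → Set Z := fun n => ⋃ x, D n x ∩ O x
  have hG : ∀ n, IsOpen (G n) := fun n => isOpen_iUnion fun x => (hDo n x).inter (hO x)
  have hfun : ∀ n, ∃ f : C(Z, ℝ), EqOn f 0 (G n)ᶜ ∧ EqOn f 1 (⋃ x, E n x) ∧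
      ∀ z, f z ∈ Icc (0 : ℝ) 1 := fun n =>
    exists_continuous_zero_one_of_isClosed (hG n).isClosed_compl
      ((hlf n).isClosed_iUnion (hEcl n))
      (disjoint_compl_left_iff_subset.2 (iUnion_mono fun x => subset_inter (hED n x) (hEO n x)))
  choose f hf0 hf1 hf using hfun
  let v : ℕ → Z → Z := fun n z => if h : ∃ x, z ∈ D n x ∩ O x then h.choose else z
  have hv : ∀ n z x, z ∈ D n x ∩ O x → v n z = x := by
    intro n z x hx
    have h : ∃ x, z ∈ D n x ∩ O x := ⟨x, hx⟩
    simp only [v, h, dif_pos]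
    by_contra hne
    exact disjoint_left.1 (hDd n _ _ hne) h.choose_spec.1 hx.1
  have hpos : ∀ n z, 0 < f n z → ∃ x, z ∈ D n x ∩ O x := by
    intro n z h
    by_contra hz
    rw [hf0 n (fun h => hz (mem_iUnion.1 h))] at h
    exact lt_irrefl _ h
  refine ⟨fun n => f n, v, fun n => (f n).continuous, fun n z => (hf n z).1,
    fun n z => (hf n z).2, ?_, ?_, ?_⟩
  · intro z
    obtain ⟨x, hx, hxV⟩ := hfirst z
    obtain ⟨n, hn⟩ := hS.exists_mem _ (hO x) z hx
    refine ⟨n, ?_⟩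
    change 0 < f n z
    rw [hf1 n (mem_iUnion.2 ⟨x, subset_closure hn, hxV⟩)]
    exact one_pos
  · intro n z₀ h
    obtain ⟨x, hx⟩ := hpos n z₀ h
    filter_upwards [((hDo n x).inter (hO x)).mem_nhds hx] with z hz
    rw [hv n z x hz, hv n z₀ x hx]
  · intro n z h
    obtain ⟨x, hx⟩ := hpos n z h
    rw [hv n z x hx]
    exact hx.2

end Stratifiable

/-! ### Construction of selection systems -/

/-- Normalization of a sequence of functions to the weights of a selection system. -/
theorem SelectionSystem.exists_of_functions {Z A : Type*} [TopologicalSpace Z] (g : ℕ → Z → ℝ)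
    (v : ℕ → Z → A) (hg : ∀ n, Continuous (g n)) (h0 : ∀ n z, 0 ≤ g n z) (h1 : ∀ n z, g n z ≤ 1)
    (hpos : ∀ z, ∃ n, 0 < g n z)
    (hv : ∀ n z₀, 0 < g n z₀ → ∀ᶠ z in 𝓝 z₀, v n z = v n z₀) :
    ∃ τ : SelectionSystem Z A, τ.value = v ∧ ∀ k z, 0 < τ.weight k z → 0 < g k z := by
  have hnn : ∀ n z, 0 ≤ (1 / 4 : ℝ) ^ n * g n z := fun n z =>
    mul_nonneg (by positivity) (h0 n z)
  have hle : ∀ n z, (1 / 4 : ℝ) ^ n * g n z ≤ (1 / 4) ^ n := fun n z =>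
    mul_le_of_le_one_right (by positivity) (h1 n z)
  have hgeo : Summable fun n : ℕ => (1 / 4 : ℝ) ^ n :=
    summable_geometric_of_lt_one (by norm_num) (by norm_num)
  have hsum : ∀ z, Summable fun n => (1 / 4 : ℝ) ^ n * g n z := fun z =>
    hgeo.of_nonneg_of_le (fun n => hnn n z) (fun n => hle n z)
  let M : Z → ℝ := fun z => ∑' n, (1 / 4 : ℝ) ^ n * g n z
  have hM : Continuous M := continuous_tsum (fun n => continuous_const.mul (hg n)) hgeo
    fun n z => by rw [Real.norm_of_nonneg (hnn n z)]; exact hle n z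
  have hMpos : ∀ z, 0 < M z := fun z => by
    obtain ⟨n, hn⟩ := hpos z
    exact (hsum z).tsum_pos (fun n => hnn n z) n (by positivity)
  have hw : ∀ k, Continuous fun z => 8 * (1 / 2 : ℝ) ^ k * g k z / M z - 2 := fun k =>
    ((continuous_const.mul (hg k)).div hM fun z => (hMpos z).ne').sub continuous_const
  have hwpos : ∀ k z, g k z ≤ 0 → 8 * (1 / 2 : ℝ) ^ k * g k z / M z - 2 < 0 := fun k z h => by
    rw [le_antisymm h (h0 k z)]; norm_num
  -- Subtracting 2 makes a weight negative near every zero of g k, where v k need not be locally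
  -- constant. If all weights were at most 1, then (1/4)^n g n ≤ (3/8) (1/2)^n M, and summation
  -- would give M < M.
  refine ⟨⟨fun k z => 8 * (1 / 2) ^ k * g k z / M z - 2, v, hw, ?_, ?_⟩, rfl, ?_⟩
  · intro k z₀
    rcases lt_or_ge 0 (g k z₀) with h | h
    · exact (hv k z₀ h).mono fun z hz => Or.inr hz
    · exact (((hw k).tendsto z₀).eventually_lt_const (hwpos k z₀ h)).mono fun z hz => Or.inl hz.le
  · intro z
    by_contra hcon
    push Not at hcon
    have hlt : ∀ n, (1 / 4 : ℝ) ^ n * g n z < (1 / 2) ^ n * (M z / 2) := by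
      intro n
      have h2 : 8 * (1 / 2 : ℝ) ^ n * g n z / M z ≤ 3 := by linarith [hcon n]
      rw [div_le_iff₀ (hMpos z)] at h2
      have h3 : (1 / 4 : ℝ) ^ n = (1 / 2) ^ n * (1 / 2) ^ n := by
        rw [← mul_pow]; norm_num
      rw [h3, mul_assoc]
      have : (0 : ℝ) < (1 / 2) ^ n := by positivity
      refine mul_lt_mul_of_pos_left ?_ this
      linarith [hMpos z]
    have hs2 : HasSum (fun n : ℕ => (1 / 2 : ℝ) ^ n * (M z / 2)) (2 * (M z / 2)) :=
      hasSum_geometric_two.mul_right _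
    have := Summable.tsum_lt_tsum (fun n => (hlt n).le) (hlt 0) (hsum z) hs2.summable
    rw [hs2.tsum_eq] at this
    change M z < _ at this
    linarith
  · intro k z h
    by_contra hcon
    exact absurd (hwpos k z (not_lt.1 hcon)) (not_lt.2 (le_of_lt h))

theorem SelectionSystem.exists_of_open_cover {Z : Type*} [TopologicalSpace Z]
    [StratifiableSpace Z] (O : Z → Set Z) (hO : ∀ x, IsOpen (O x)) (hmem : ∀ x, x ∈ O x) :
    ∃ τ : SelectionSystem Z Z, ∀ k z, 0 < τ.weight k z → z ∈ O (τ.value k z) := by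
  obtain ⟨g, v, hg, h0, h1, hpos, hv, hvO⟩ := exists_functions_of_open_cover O hO hmem
  obtain ⟨τ, hτ, hτg⟩ := SelectionSystem.exists_of_functions g v hg h0 h1 hpos hv
  exact ⟨τ, fun k z h => hτ ▸ hvO k z (hτg k z h)⟩

/-- The composition of a selection system with a function of the values. -/
def SelectionSystem.map {Z A B : Type*} [TopologicalSpace Z] (τ : SelectionSystem Z A)
    (f : A → B) : SelectionSystem Z B where
  weight := τ.weight
  value k z := f (τ.value k z)
  continuous_weight := τ.continuous_weight
  eventually_value k z₀ := (τ.eventually_value k z₀).mono fun _ h => h.imp id (congrArg f)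
  exists_one_lt := τ.exists_one_lt

/-- The selection system with two values, which selects the first one with probability `g`. -/
def SelectionSystem.binary {Z : Type*} [TopologicalSpace Z] (g : Z → ℝ) (hg : Continuous g) :
    SelectionSystem Z ℕ where
  weight
    | 0 => g
    | 1 => fun _ => 2
    | _ => fun _ => 0
  value k _ := min k 1
  continuous_weight
    | 0 => hg
    | 1 => continuous_const
    | _ + 2 => continuous_const
  eventually_value _ _ := Eventually.of_forall fun _ => Or.inr rfl
  exists_one_lt _ := ⟨1, one_lt_two⟩

namespace SelectionSystem

variable {Z : Type*} [TopologicalSpace Z] {g : Z → ℝ} (hg : Continuous g)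

theorem binary_select_of_lt {z : Z} {t : I} (h : (t : ℝ) < g z) :
    (binary g hg).select z t = 0 := by
  have : (binary g hg).index z t = 0 := Nat.le_zero.1 ((binary g hg).index_le h)
  rw [select, this]
  rfl

theorem binary_select_of_nonpos {z : Z} (h : g z ≤ 0) (t : I) :
    (binary g hg).select z t = 1 := by
  have : (binary g hg).index z t ≠ 0 := by
    intro h0
    have := (binary g hg).weight_index_pos z t
    rw [h0] at this
    exact absurd this (not_lt.2 h)
  rw [select]
  exact min_eq_right (Nat.one_le_iff_ne_zero.2 this)

theorem encard_binary_weight_le (z : Z) : {k | 0 < (binary g hg).weight k z}.encard ≤ 2 := by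
  refine (encard_le_encard (t := {0, 1}) ?_).trans (encard_insert_le _ _ |>.trans (by
    rw [encard_singleton]; norm_num))
  rintro (_ | _ | k) hk
  · simp
  · simp
  · exact absurd hk (lt_irrefl (0 : ℝ))

theorem finite_binary_value : {w | ∃ k z, (binary g hg).value k z = w}.Finite := by
  refine (finite_Iic 1).subset ?_
  rintro w ⟨k, z, rfl⟩
  exact min_le_right k 1

end SelectionSystem

/-! ### From covers to extension data -/

/-- Ingredients for the construction of extension operators: a function vanishing exactly on `X`,
a cover of the complement with associated points of `X`, converging at the points of `X`, and a
sequence of covers of the complement which separates points. -/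
structure ExtensionGeometry {Y : Type*} [TopologicalSpace Y] (X : Set Y) where
  /-- The function vanishing exactly on `X`. -/
  scale : Y → ℝ
  /-- The cover. -/
  cover : (Xᶜ : Set Y) → Set (Xᶜ : Set Y)
  /-- The points of `X` associated with the members of the cover. -/
  center : (Xᶜ : Set Y) → X
  /-- The separating covers. -/
  separator : ℕ → (Xᶜ : Set Y) → Set (Xᶜ : Set Y)
  continuous_scale : Continuous scale
  scale_le_one : ∀ y, scale y ≤ 1
  scale_eq_zero : ∀ y ∈ X, scale y = 0
  scale_pos : ∀ y ∉ X, 0 < scale y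
  isOpen_cover : ∀ x, IsOpen (cover x)
  mem_cover : ∀ x, x ∈ cover x
  eventually_center : ∀ x₀ : X, ∀ U ∈ 𝓝 x₀, ∀ᶠ y in 𝓝 (x₀ : Y), ∀ (hy : y ∉ X) x,
    ⟨y, hy⟩ ∈ cover x → center x ∈ U
  isOpen_separator : ∀ m x, IsOpen (separator m x)
  mem_separator : ∀ m x, x ∈ separator m x
  separates : ∀ z z', z ≠ z' → ∃ m, ∀ x, ¬ (z ∈ separator m x ∧ z' ∈ separator m x)

/-- The additional properties of the ingredients which ensure that dominating metrics are
preserved. -/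
structure ExtensionGeometry.IsDominating {Y : Type*} [TopologicalSpace Y] {X : Set Y}
    (G : ExtensionGeometry X) : Prop where
  separates : ∀ z₀ : (Xᶜ : Set Y), ∀ U ∈ 𝓝 (z₀ : Y), ∃ m, ∀ z : (Xᶜ : Set Y), (z : Y) ∉ U →
    ∀ x, ¬ (z₀ ∈ G.separator m x ∧ z ∈ G.separator m x)
  mem_of_center : ∀ x₀ : X, ∀ U ∈ 𝓝 (x₀ : Y), ∃ V ∈ 𝓝 x₀, ∃ δ > 0, ∀ z : (Xᶜ : Set Y),
    G.scale z < δ → (∃ x, z ∈ G.cover x ∧ G.center x ∈ V) → (z : Y) ∈ U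

/-- Extension data which realize the given ingredients. -/
structure ExtensionData.Realizes {Y L : Type*} [TopologicalSpace Y] {X : Set Y}
    (d : ExtensionData X L) (G : ExtensionGeometry X) : Prop where
  scale_eq : d.scale = G.scale
  main_value : ∀ k z, 0 < d.main.weight k z → ∃ x, z ∈ G.cover x ∧ d.main.value k z = G.center x
  label_ne : ∀ m z₀, ∃ j, ∃ η > 0, ∀ z, (∀ x, ¬ (z₀ ∈ G.separator m x ∧ z ∈ G.separator m x)) →
    ∀ t : I, (t : ℝ) < η → (d.label j).select z₀ t ≠ (d.label j).select z t

namespace ExtensionData.Realizes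

variable {Y L : Type*} [TopologicalSpace Y] {X : Set Y} {d : ExtensionData X L}
  {G : ExtensionGeometry X} (ν : Measure ℕ) [IsProbabilityMeasure ν] {a b : X}

theorem isGoodExtension (h : d.Realizes G) (hν : ∀ m, 0 < ν.real {m}) (hab : a ≠ b)
    (hX : IsClosed X) : IsGoodExtension (d.extensionOperator ν a b) := by
  refine d.isGoodExtension ν hν hab hX fun z z' hz => ?_
  obtain ⟨m, hm⟩ := G.separates z z' hz
  obtain ⟨j, η, hη, hj⟩ := h.label_ne m z
  exact ⟨j, η, hη, hj z' hm⟩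

theorem preservesDominatingAdmissible (h : d.Realizes G) (hν : ∀ m, 0 < ν.real {m}) (hab : a ≠ b)
    (hX : IsClosed X) (hG : G.IsDominating) :
    PreservesDominatingAdmissible (d.extensionOperator ν a b) := by
  refine d.preservesDominatingAdmissible ν hν hab (h.isGoodExtension ν hν hab hX) ?_ ?_
  · intro z₀ U hU
    obtain ⟨m, hm⟩ := hG.separates z₀ U hU
    obtain ⟨j, η, hη, hj⟩ := h.label_ne m z₀
    exact ⟨j, η, hη, fun z hz => hj z (hm z hz)⟩
  · intro x₀ U hU
    obtain ⟨V, hV, δ, hδ, hz⟩ := hG.mem_of_center x₀ U hU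
    refine ⟨V, hV, δ, hδ, fun z hs ⟨k, hk, hkV⟩ => hz z (h.scale_eq ▸ hs) ?_⟩
    obtain ⟨x, hx, hxk⟩ := h.main_value k z hk
    exact ⟨x, hx, hxk ▸ hkV⟩

end ExtensionData.Realizes

/-- The extension data defined by the ingredients and by selection systems. -/
def ExtensionGeometry.toData {Y L : Type*} [TopologicalSpace Y] {X : Set Y}
    (G : ExtensionGeometry X) (τ : SelectionSystem (Xᶜ : Set Y) (Xᶜ : Set Y))
    (hτ : ∀ k z, 0 < τ.weight k z → z ∈ G.cover (τ.value k z))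
    (label : ℕ → SelectionSystem (Xᶜ : Set Y) L) : ExtensionData X L where
  scale := G.scale
  main := τ.map G.center
  label := label
  continuous_scale := G.continuous_scale
  scale_le_one := G.scale_le_one
  scale_eq_zero := G.scale_eq_zero
  scale_pos := G.scale_pos
  eventually_main x₀ U hU := (G.eventually_center x₀ U hU).mono fun _ hy hyX k hk =>
    hy hyX _ (hτ k _ hk)

theorem SelectionSystem.mem_of_select_eq {Z A : Type*} [TopologicalSpace Z]
    {τ : SelectionSystem Z A} {P : A → Set Z} (hτ : ∀ k z, 0 < τ.weight k z → z ∈ P (τ.value k z))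
    {z z' : Z} {t : I} (h : τ.select z t = τ.select z' t) : ∃ x, z ∈ P x ∧ z' ∈ P x :=
  ⟨τ.select z t, hτ _ z (τ.weight_index_pos z t), h ▸ hτ _ z' (τ.weight_index_pos z' t)⟩

theorem ExtensionGeometry.exists_data {Y : Type*} [TopologicalSpace Y] [StratifiableSpace Y]
    {X : Set Y} (hX : IsClosed X) (G : ExtensionGeometry X) :
    ∃ d : ExtensionData X (Xᶜ : Set Y), d.Realizes G ∧ ∀ m z z' (t : I),
      (d.label m).select z t = (d.label m).select z' t →
      ∃ x, z ∈ G.separator m x ∧ z' ∈ G.separator m x := by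
  have := hX.isOpen_compl.stratifiableSpace
  obtain ⟨τ, hτ⟩ := SelectionSystem.exists_of_open_cover G.cover G.isOpen_cover G.mem_cover
  choose l hl using fun m => SelectionSystem.exists_of_open_cover (G.separator m)
    (G.isOpen_separator m) (G.mem_separator m)
  have key : ∀ m z z' (t : I), (l m).select z t = (l m).select z' t →
      ∃ x, z ∈ G.separator m x ∧ z' ∈ G.separator m x := fun m z z' t h =>
    SelectionSystem.mem_of_select_eq (hl m) h
  refine ⟨G.toData τ hτ l, ⟨rfl, fun k z hk => ⟨_, hτ k z hk, rfl⟩, fun m z₀ =>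
    ⟨m, 1, one_pos, fun z hz t _ heq => ?_⟩⟩, key⟩
  obtain ⟨x, hx⟩ := key m z₀ z t heq
  exact hz x hx

/-! ### Separable spaces with finite-dimensional complement -/

section FiniteDimensional

variable {Z : Type*} [TopologicalSpace Z] [TopologicalSpace.SeparableSpace Z]

/-- Each nonempty member of a refinement of finite order meets a countable dense set, each point of
which lies in finitely many members, so the refinement is countable. -/
theorem CoveringDimLE.exists_countable_refinement {n : ℕ} (hn : CoveringDimLE Z n)
    (O : Z → Set Z) (hO : ∀ x, IsOpen (O x)) (hmem : ∀ x, x ∈ O x) :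
    ∃ V : ℕ → Set Z, (∀ k, IsOpen (V k)) ∧ (∀ z, ∃ k, z ∈ V k) ∧
      (∀ k, (V k).Nonempty → ∃ x, V k ⊆ O x) ∧ ∀ z, {k | z ∈ V k}.encard ≤ n + 1 := by
  obtain ⟨𝒱, hVo, hVc, hVr, hVn⟩ := hn (range O) (by rintro _ ⟨x, rfl⟩; exact hO x)
    (eq_univ_of_forall fun z => ⟨O z, mem_range_self z, hmem z⟩)
  let 𝒲 : Set (Set Z) := {V ∈ 𝒱 | V.Nonempty}
  have hcount : 𝒲.Countable := by
    obtain ⟨D, hD, hDd⟩ := TopologicalSpace.exists_countable_dense Z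
    refine (hD.biUnion fun z _ => (finite_of_encard_le_coe (k := n + 1)
      (by exact_mod_cast hVn z)).countable).mono ?_
    rintro V ⟨hV, hne⟩
    obtain ⟨z, hz, hzD⟩ := hDd.inter_open_nonempty V (hVo V hV) hne
    exact mem_biUnion hzD ⟨hV, hz⟩
  obtain ⟨e, he⟩ := (countable_iff_exists_injOn.1 hcount)
  have hV : ∀ k z, (∃ V ∈ 𝒲, e V = k ∧ z ∈ V) ↔ z ∈ ⋃₀ {V ∈ 𝒲 | e V = k} := by
    intro k z
    simp only [mem_sUnion, mem_ofPred_eq, and_assoc]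
  refine ⟨fun k => ⋃₀ {V ∈ 𝒲 | e V = k}, fun k => isOpen_sUnion fun V hV => hVo V hV.1.1, ?_, ?_,
    ?_⟩
  · intro z
    obtain ⟨V, hV𝒱, hzV⟩ := (hVc ▸ mem_univ z : z ∈ ⋃₀ 𝒱)
    exact ⟨e V, V, ⟨⟨hV𝒱, ⟨z, hzV⟩⟩, rfl⟩, hzV⟩
  · rintro k ⟨z, hz⟩
    obtain ⟨V, hVW, hVk, hzV⟩ := (hV k z).2 hz
    obtain ⟨_, ⟨x, rfl⟩, hx⟩ := hVr V hVW.1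
    refine ⟨x, fun w hw => ?_⟩
    obtain ⟨V', hVW', hVk', hwV'⟩ := (hV k w).2 hw
    exact hx (he hVW hVW' (hVk.trans hVk'.symm) ▸ hwV')
  · intro z
    refine (encard_le_encard (t := e '' {V ∈ 𝒱 | z ∈ V}) ?_).trans
      ((encard_image_le _ _).trans (hVn z))
    intro k hk
    obtain ⟨V, hVW, hVk, hzV⟩ := (hV k z).2 hk
    exact ⟨V, ⟨hVW.1, hzV⟩, hVk⟩

theorem SelectionSystem.exists_of_coveringDimLE [StratifiableSpace Z] {n : ℕ}
    (hn : CoveringDimLE Z n) (O : Z → Set Z) (hO : ∀ x, IsOpen (O x)) (hmem : ∀ x, x ∈ O x) :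
    ∃ τ : SelectionSystem Z Z, (∀ k z, 0 < τ.weight k z → z ∈ O (τ.value k z)) ∧
      ∀ z, {k | 0 < τ.weight k z}.encard ≤ (n + 1 : ℕ) := by
  classical
  obtain ⟨V, hVo, hVc, hVr, hVn⟩ := hn.exists_countable_refinement O hO hmem
  choose g hg h0 h1 hgV using fun k => (hVo k).exists_continuous_pos_iff
  let v : ℕ → Z → Z := fun k z => if h : (V k).Nonempty then (hVr k h).choose else z
  have hv : ∀ k (h : (V k).Nonempty) z, v k z = (hVr k h).choose := fun k h z => by
    simp only [v, h, dif_pos]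
  obtain ⟨τ, hτ, hτg⟩ := SelectionSystem.exists_of_functions g v hg h0 h1
    (fun z => (hVc z).imp fun k hk => (hgV k z).2 hk)
    (fun k z₀ hk => Eventually.of_forall fun z => by
      have h : (V k).Nonempty := ⟨z₀, (hgV k z₀).1 hk⟩
      rw [hv k h, hv k h])
  refine ⟨τ, fun k z hk => ?_, fun z => ?_⟩
  · have hz := (hgV k z).1 (hτg k z hk)
    rw [hτ, hv k ⟨z, hz⟩]
    exact (hVr k ⟨z, hz⟩).choose_spec hz
  · refine (encard_le_encard fun k hk => (hgV k z).1 (hτg k z hk)).trans ((hVn z).trans ?_)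
    push_cast
    exact le_rfl

end FiniteDimensional

theorem ExtensionGeometry.exists_data_of_coveringDimLE {Y : Type*} [TopologicalSpace Y]
    [StratifiableSpace Y] [TopologicalSpace.SeparableSpace Y] {X : Set Y} (hX : IsClosed X)
    (G : ExtensionGeometry X) {n : ℕ} (hn : CoveringDimLE (Xᶜ : Set Y) n) :
    ∃ d : ExtensionData X ℕ, d.Realizes G ∧
      (∀ z, {k | 0 < d.main.weight k z}.encard ≤ (n + 2 : ℕ)) ∧
      (∀ m z, {k | 0 < (d.label m).weight k z}.encard ≤ (n + 2 : ℕ)) ∧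
      ∀ m, {w | ∃ k z, (d.label m).value k z = w}.Finite := by
  have := hX.isOpen_compl.stratifiableSpace
  have := hX.isOpen_compl.isOpenEmbedding_subtypeVal.separableSpace
  obtain ⟨τ, hτ, hτn⟩ := SelectionSystem.exists_of_coveringDimLE hn G.cover G.isOpen_cover
    G.mem_cover
  choose V hVo hVc hVr _ using fun m => hn.exists_countable_refinement (G.separator m)
    (G.isOpen_separator m) (G.mem_separator m)
  choose g hg h0 h1 hgV using fun m k => (hVo m k).exists_continuous_pos_iff
  -- A countable separating cover is spread over infinitely many two-valued systems, one for each
  -- pair (cover, member), so that every single system has finitely many labels. A pair of points is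
  -- then separated only for small t, namely below the weight of a member containing the first
  -- point.
  let l : ℕ → SelectionSystem (Xᶜ : Set Y) ℕ := fun j =>
    SelectionSystem.binary (g j.unpair.1 j.unpair.2) (hg _ _)
  refine ⟨G.toData τ hτ l, ⟨rfl, fun k z hk => ⟨_, hτ k z hk, rfl⟩, fun m z₀ => ?_⟩,
    fun z => (hτn z).trans (by exact_mod_cast Nat.le_succ _),
    fun m z => (SelectionSystem.encard_binary_weight_le (hg _ _) z).trans
      (by exact_mod_cast Nat.le_add_left 2 n),
    fun m => SelectionSystem.finite_binary_value (hg _ _)⟩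
  obtain ⟨k, hk⟩ := hVc m z₀
  have hl : l (Nat.pair m k) = SelectionSystem.binary (g m k) (hg m k) := by
    simp only [l]
    congr 1; simp
  refine ⟨Nat.pair m k, g m k z₀, (hgV m k z₀).2 hk, fun z hz t ht => ?_⟩
  change (l (Nat.pair m k)).select z₀ t ≠ (l (Nat.pair m k)).select z t
  have hgz : g m k z ≤ 0 := by
    by_contra hcon
    obtain ⟨x, hx⟩ := hVr m k ⟨z₀, hk⟩
    exact hz x ⟨hx hk, hx ((hgV m k z).1 (not_le.1 hcon))⟩
  rw [hl, SelectionSystem.binary_select_of_lt _ ht, SelectionSystem.binary_select_of_nonpos _ hgz]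
  exact zero_ne_one

/-! ### Covers converging at a closed subset of a stratifiable space -/

namespace IsStratification

variable {Y : Type*} [TopologicalSpace Y] {S : Set Y → ℕ → Set Y}

open scoped Classical in
/-- The first index at which a point belongs to the stratum of a set. -/
noncomputable def rank (S : Set Y → ℕ → Set Y) (U : Set Y) (x : Y) : ℕ :=
  if h : ∃ n, x ∈ S U n then Nat.find h else 0

/-- A neighborhood of `x` in `U` defined by a stratification. -/
def core (S : Set Y → ℕ → Set Y) (U : Set Y) (x : Y) : Set Y :=
  S U (rank S U x) \ closure (S {x}ᶜ (rank S U x))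

theorem isOpen_core (hS : IsStratification S) {U : Set Y} (hU : IsOpen U) (x : Y) :
    IsOpen (core S U x) :=
  (hS.isOpen U hU _).sdiff isClosed_closure

variable [T1Space Y]

theorem mem_core (hS : IsStratification S) {U : Set Y} (hU : IsOpen U) {x : Y} (hx : x ∈ U) :
    x ∈ core S U x := by
  classical
  have h := hS.exists_mem U hU x hx
  refine ⟨?_, fun h => hS.closure_subset _ isOpen_compl_singleton _ h rfl⟩
  rw [rank, dif_pos h]
  exact Nat.find_spec h

/-- If y were not in U, then U would lie in {y}ᶜ, and the stratum of U containing z would lie in the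
stratum of {y}ᶜ that the core around y avoids. -/
theorem mem_of_mem_core (hS : IsStratification S) {U V : Set Y} (hU : IsOpen U) {x y z : Y}
    (hx : z ∈ core S U x) (hy : z ∈ core S V y) (h : rank S U x ≤ rank S V y) : y ∈ U := by
  by_contra hyU
  exact hy.2 (subset_closure (hS.mono₂ hU isOpen_compl_singleton
    (subset_compl_singleton_iff.2 hyU) h hx.1))

theorem exists_convergent_cover (hS : IsStratification S) {X : Set Y} (hX : IsClosed X)
    (hne : X.Nonempty) : ∃ c : Y → X, ∀ x₀ : X, ∀ U ∈ 𝓝 x₀, ∀ᶠ y in 𝓝 (x₀ : Y), ∀ x ∉ X,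
      y ∈ core S Xᶜ x → c x ∈ U := by
  have hW : IsOpen Xᶜ := hX.isOpen_compl
  have hc : ∀ x, ∃ c : X, x ∉ X → ∀ U, IsOpen U → ∀ b : X, (b : Y) ∈ U → x ∈ core S U b →
      ∃ V, IsOpen V ∧ (c : Y) ∈ V ∧ x ∈ core S V c ∧ rank S U b ≤ rank S V c := by
    intro x
    by_cases hx : x ∈ X
    · exact ⟨⟨x, hx⟩, fun h => absurd hx h⟩
    let K : Set ℕ := {n | ∃ U, IsOpen U ∧ ∃ b : X, (b : Y) ∈ U ∧ x ∈ core S U b ∧ rank S U b = n}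
    -- A rank above that of x in Xᶜ would, by `mem_of_mem_core`, put the point b of X into Xᶜ. Hence
    -- a center c of maximal rank exists.
    have hbdd : BddAbove K := by
      refine ⟨rank S Xᶜ x, ?_⟩
      rintro _ ⟨U, hU, b, hb, hxb, rfl⟩
      by_contra hlt
      exact hS.mem_of_mem_core hW (hS.mem_core hW hx) hxb (not_le.1 hlt).le b.2
    by_cases hK : K.Nonempty
    · obtain ⟨V, hV, c, hc, hxc, hr⟩ := Nat.sSup_mem hK hbdd
      exact ⟨c, fun _ U hU b hb hxb => ⟨V, hV, hc, hxc, hr ▸ le_csSup hbdd ⟨U, hU, b, hb, hxb, rfl⟩⟩⟩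
    · exact ⟨⟨_, hne.some_mem⟩, fun _ U hU b hb hxb => absurd ⟨_, U, hU, b, hb, hxb, rfl⟩ hK⟩
  choose c hc using hc
  refine ⟨c, fun x₀ U' hU' => ?_⟩
  obtain ⟨u, hu, huU'⟩ := (mem_nhds_subtype _ _ _).1 hU'
  obtain ⟨U, hUu, hU, hx₀⟩ := mem_nhds_iff.1 hu
  have hU₁ := hS.isOpen_core hU (x₀ : Y)
  have hx₁ := hS.mem_core hU hx₀
  -- The core is taken twice: the outer one brings x into the core of U at x₀, and then the
  -- maximality of the rank of c, through the inner one, brings c into U.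
  filter_upwards [(hS.isOpen_core hU₁ (x₀ : Y)).mem_nhds (hS.mem_core hU₁ hx₁)] with y hy x hx hyx
  have hlt : rank S (core S U x₀) x₀ ≤ rank S Xᶜ x := by
    by_contra hcon
    exact hS.mem_of_mem_core hW hyx hy (not_le.1 hcon).le x₀.2
  have hxU : x ∈ core S U x₀ := hS.mem_of_mem_core hU₁ hy hyx hlt
  obtain ⟨V, hV, hcV, hxV, hr⟩ := hc x hx U hU x₀ hx₀ hxU
  exact huU' (hUu (hS.mem_of_mem_core hU hxU hxV hr))

/-- This makes the complements of these closures separating covers: two points sharing a member at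
every level n would both be limits of one sequence. -/
theorem tendsto_of_mem_compl_closure (hS : IsStratification S) {x : ℕ → Y} {z : Y}
    (h : ∀ n, z ∉ closure (S {x n}ᶜ n)) : Tendsto x atTop (𝓝 z) := by
  rw [tendsto_nhds]
  intro U hU hz
  obtain ⟨N, hN⟩ := hS.exists_mem U hU z hz
  filter_upwards [eventually_ge_atTop N] with n hn
  by_contra hcon
  exact h n (subset_closure (hS.mono₂ hU isOpen_compl_singleton
    (subset_compl_singleton_iff.2 hcon) hn hN))

end IsStratification

theorem StratifiableSpace.exists_extensionGeometry {Y : Type*} [TopologicalSpace Y]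
    [StratifiableSpace Y] {X : Set Y} (hX : IsClosed X) (hne : X.Nonempty) :
    Nonempty (ExtensionGeometry X) := by
  have := hX.isOpen_compl.stratifiableSpace
  obtain ⟨S, hS⟩ := exists_isStratification Y
  obtain ⟨R, hR⟩ := exists_isStratification (Xᶜ : Set Y)
  obtain ⟨s, hs, hs0, hs1, hsX⟩ := hX.isOpen_compl.exists_continuous_pos_iff
  obtain ⟨c, hc⟩ := hS.exists_convergent_cover hX hne
  refine ⟨⟨s, fun x => Subtype.val ⁻¹' IsStratification.core S Xᶜ (x : Y), fun x => c x,
    fun m x => (closure (R {x}ᶜ m))ᶜ, hs, hs1,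
    fun y hy => le_antisymm (not_lt.1 fun h => (hsX y).1 h hy) (hs0 y), fun y hy => (hsX y).2 hy,
    fun x => (hS.isOpen_core hX.isOpen_compl _).preimage continuous_subtype_val,
    fun x => hS.mem_core hX.isOpen_compl x.2, ?_, fun m x => isClosed_closure.isOpen_compl,
    fun m x h => hR.closure_subset _ isOpen_compl_singleton m h rfl, ?_⟩⟩
  · intro x₀ U hU
    filter_upwards [hc x₀ U hU] with y hy hyX x hx
    exact hy x x.2 hx
  · intro z z' hne
    by_contra! hcon
    choose x hx using hcon
    exact hne (tendsto_nhds_unique (hR.tendsto_of_mem_compl_closure fun n => (hx n).1)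
      (hR.tendsto_of_mem_compl_closure fun n => (hx n).2))

/-! ### Covers in metric spaces -/

theorem exists_extensionGeometry_of_metricSpace {Y : Type*} [MetricSpace Y] {X : Set Y}
    (hX : IsClosed X) (hne : X.Nonempty) :
    ∃ G : ExtensionGeometry X, G.IsDominating ∧
      (∀ ε > 0, ∃ δ > 0, ∀ y, G.scale y < δ → Metric.infDist y X < ε) ∧
      ∀ ε > 0, ∃ m, ∀ x, ∀ z ∈ G.separator m x, ∀ z' ∈ G.separator m x, dist (z : Y) z' < ε := by
  have hpos : ∀ y, y ∉ X → 0 < Metric.infDist y X := fun y hy =>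
    (hX.notMem_iff_infDist_pos hne).1 hy
  have hc : ∀ x : (Xᶜ : Set Y), ∃ c : X, dist (x : Y) c < 2 * Metric.infDist (x : Y) X := by
    intro x
    obtain ⟨c, hc, hlt⟩ := (Metric.infDist_lt_iff hne).1
      (by linarith [hpos x x.2] : Metric.infDist (x : Y) X < 2 * Metric.infDist (x : Y) X)
    exact ⟨⟨c, hc⟩, hlt⟩
  choose c hc using hc
  let O : (Xᶜ : Set Y) → Set (Xᶜ : Set Y) := fun x => Metric.ball x (Metric.infDist (x : Y) X / 4)
  -- With r and R the distances of z and x to X, R ≤ r + R/4 gives R ≤ 4r/3, so the distance from z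
  -- to c x is at most R/4 + 2R ≤ 3r.
  have hOc : ∀ z x, z ∈ O x → dist (z : Y) (c x) ≤ 3 * Metric.infDist (z : Y) X := by
    intro z x hz
    have h1 : dist (z : Y) x < Metric.infDist (x : Y) X / 4 := hz
    have h2 := Metric.infDist_le_infDist_add_dist (s := X) (x := (x : Y)) (y := (z : Y))
    rw [dist_comm] at h2
    linarith [hc x, dist_triangle (z : Y) x (c x)]
  let P : ℕ → (Xᶜ : Set Y) → Set (Xᶜ : Set Y) := fun m x => Metric.ball x (1 / ((m : ℝ) + 1) / 2)
  have hP : ∀ ε > 0, ∃ m, ∀ x, ∀ z ∈ P m x, ∀ z' ∈ P m x, dist (z : Y) z' < ε := by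
    intro ε hε
    obtain ⟨m, hm⟩ := exists_nat_one_div_lt hε
    refine ⟨m, fun x z hz z' hz' => ?_⟩
    have h1 : dist (z : Y) x < _ := hz
    have h2 : dist (z' : Y) x < _ := hz'
    linarith [dist_triangle_right (z : Y) z' x]
  have hscale : ∀ ε > 0, ∃ δ > 0, ∀ y, min (Metric.infDist y X) 1 < δ → Metric.infDist y X < ε := by
    intro ε hε
    refine ⟨min ε 1, by positivity, fun y hy => ?_⟩
    rcases min_lt_iff.1 hy with h | h
    · exact h.trans_le (min_le_left _ _)
    · exact absurd (min_le_right ε 1) (not_le.2 h)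
  refine ⟨⟨fun y => min (Metric.infDist y X) 1, O, c, P,
    (Metric.continuous_infDist_pt X).min continuous_const, fun y => min_le_right _ _,
    fun y hy => by simp [Metric.infDist_zero_of_mem hy],
    fun y hy => lt_min (hpos y hy) one_pos, fun x => Metric.isOpen_ball,
    fun x => Metric.mem_ball_self (by linarith [hpos x x.2]), ?_, fun m x => Metric.isOpen_ball,
    fun m x => Metric.mem_ball_self (by positivity), ?_⟩, ⟨?_, ?_⟩, hscale, hP⟩
  · intro x₀ U hU
    obtain ⟨ε, hε, hεU⟩ := Metric.mem_nhds_iff.1 hU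
    filter_upwards [Metric.ball_mem_nhds (x₀ : Y) (by positivity : 0 < ε / 4)] with y hy hyX x hx
    refine hεU ?_
    have h1 := hOc _ x hx
    have h2 : Metric.infDist y X ≤ dist y x₀ := Metric.infDist_le_dist_of_mem x₀.2
    have h3 := dist_triangle_left (c x : Y) x₀ y
    rw [Metric.mem_ball] at hy
    change dist (c x : Y) x₀ < ε
    simp only at h1
    linarith
  · intro z z' hne
    obtain ⟨m, hm⟩ := hP (dist (z : Y) z') (dist_pos.2 fun h => hne (Subtype.ext h))
    exact ⟨m, fun x hx => lt_irrefl _ (hm x z hx.1 z' hx.2)⟩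
  · intro z₀ U hU
    obtain ⟨ε, hε, hεU⟩ := Metric.mem_nhds_iff.1 hU
    obtain ⟨m, hm⟩ := hP ε hε
    refine ⟨m, fun z hz x hx => hz (hεU ?_)⟩
    rw [Metric.mem_ball, dist_comm]
    exact hm x z₀ hx.1 z hx.2
  · intro x₀ U hU
    obtain ⟨ε, hε, hεU⟩ := Metric.mem_nhds_iff.1 hU
    -- The distance from z to x₀ is below 3 · ε/6 + ε/2 = ε.
    obtain ⟨δ, hδ, hδε⟩ := hscale (ε / 6) (by positivity)
    refine ⟨Metric.ball x₀ (ε / 2), Metric.ball_mem_nhds _ (by positivity), δ, hδ,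
      fun z hz ⟨x, hx, hxV⟩ => hεU ?_⟩
    have h1 := hOc z x hx
    have h2 := hδε z hz
    have h3 : dist (c x : Y) x₀ < ε / 2 := hxV
    rw [Metric.mem_ball]
    linarith [dist_triangle (z : Y) (c x) x₀]

/-! ### Assembly -/

theorem exists_extensionGeometry {Y : Type*} [TopologicalSpace Y] [StratifiableSpace Y]
    {X : Set Y} (hX : IsClosed X) (hne : X.Nonempty) :
    ∃ G : ExtensionGeometry X, TopologicalSpace.MetrizableSpace Y → G.IsDominating := by
  by_cases h : TopologicalSpace.MetrizableSpace Y
  · let _ := TopologicalSpace.metrizableSpaceMetric Y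
    obtain ⟨G, hG, -⟩ := exists_extensionGeometry_of_metricSpace hX hne
    exact ⟨G, fun _ => hG⟩
  · obtain ⟨G⟩ := StratifiableSpace.exists_extensionGeometry hX hne
    exact ⟨G, fun h' => absurd h' h⟩

theorem theorem3p1 {Y : Type*} [TopologicalSpace Y] [StratifiableSpace Y]
    (X : Set Y) (hX : IsClosed X) (hX' : X.Nontrivial) :
    (∃ T : (X × X → ℝ) →ₗ[ℝ] (Y × Y → ℝ), IsGoodExtension T ∧
      (TopologicalSpace.MetrizableSpace Y → PreservesDominatingAdmissible T)) ∧
    (TopologicalSpace.IsCompletelyMetrizableSpace Y → IsCompact X →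
      ∃ T : (X × X → ℝ) →ₗ[ℝ] (Y × Y → ℝ), IsGoodExtension T ∧
        PreservesDominatingAdmissible T ∧
        ∀ p, IsCompleteAdmissibleMetric p → IsCompleteAdmissibleMetric (T p)) ∧
    (TopologicalSpace.SeparableSpace Y → (∃ n : ℕ, CoveringDimLE (Xᶜ : Set Y) n) →
      ∃ T : (X × X → ℝ) →ₗ[ℝ] (Y × Y → ℝ), IsGoodExtension T ∧
        (TopologicalSpace.MetrizableSpace Y → PreservesDominatingAdmissible T) ∧
        ∀ p, IsTotallyBoundedPseudometric p → IsTotallyBoundedPseudometric (T p)) := by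
  obtain ⟨a, ha, b, hb, hne⟩ := hX'
  have hab : (⟨a, ha⟩ : X) ≠ ⟨b, hb⟩ := fun h => hne (congrArg Subtype.val h)
  -- Any probability measure charging every natural number would serve.
  let ν : Measure ℕ := ProbabilityTheory.poissonMeasure 1
  have hν : ∀ m, 0 < ν.real {m} := fun m =>
    ProbabilityTheory.poissonMeasure_real_singleton_pos m one_pos
  obtain ⟨G, hG⟩ := exists_extensionGeometry hX ⟨a, ha⟩
  refine ⟨?_, ?_, ?_⟩
  · obtain ⟨d, hd, -⟩ := G.exists_data hX
    exact ⟨d.extensionOperator ν ⟨a, ha⟩ ⟨b, hb⟩, hd.isGoodExtension ν hν hab hX,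
      fun h => hd.preservesDominatingAdmissible ν hν hab hX (hG h)⟩
  · intro hY hXc
    let _ := TopologicalSpace.upgradeIsCompletelyMetrizable Y
    obtain ⟨G, hG, hscale, hsep⟩ := exists_extensionGeometry_of_metricSpace hX ⟨a, ha⟩
    obtain ⟨d, hd, hlabel⟩ := G.exists_data hX
    have hdom := hd.preservesDominatingAdmissible ν hν hab hX hG
    refine ⟨d.extensionOperator ν ⟨a, ha⟩ ⟨b, hb⟩, hd.isGoodExtension ν hν hab hX, hdom,
      fun p hp => ?_⟩
    refine d.isCompleteAdmissibleMetric ν hν hab hXc (hd.scale_eq ▸ hscale) (fun ε hε => ?_)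
      hp.toIsMetric (hdom.admissible p hp.toIsAdmissibleMetric)
    obtain ⟨m, hm⟩ := hsep ε hε
    refine ⟨m, fun z z' t h => ?_⟩
    obtain ⟨x, hx, hx'⟩ := hlabel m z z' t h
    exact hm x z hx z' hx'
  · rintro hY ⟨n, hn⟩
    obtain ⟨d, hd, hmain, hlabel, hfin⟩ := G.exists_data_of_coveringDimLE hX hn
    exact ⟨d.extensionOperator ν ⟨a, ha⟩ ⟨b, hb⟩, hd.isGoodExtension ν hν hab hX,
      fun h => hd.preservesDominatingAdmissible ν hν hab hX (hG h),
      fun p hp => d.isTotallyBoundedPseudometric ν hmain hlabel hfin hp⟩
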